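/- **Setting.** Let $p$ be an odd prime, let $R$ be the $p$-adic completion of the maximal unramified extension of $\mathbb Z_p$ (that is, $R=W(\overline{\mathbb F}_p)$), let $K=R[1/p]$, and let $\pi$ be a prime element of a finite Galois extension of $\mathbb Q_p$ contained in an algebraic closure of $K$; put $R_\pi=R[\pi]$, $K_\pi=K(\pi)$. For a ring $S\ni\pi$, a higher $\pi$-Frobenius lift of degree $s$ on $S$ is a ring endomorphism $\phi$ with $\phi(a)\equiv a^{p^s}$ mod $\pi S$ for all $a\in S$. Fix $s\ge 1$ and an $n$-tuple $\Phi^{(s)}=(\phi_1,\dots,\phi_n)$ of higher $\pi$-Frobenius lifts of degree $s$ on $R_\pi$. For a matrix $a=(a_{ij})$ put $a^{(p^s)}=(a_{ij}^{p^s})$. For $N\geq 1$ let $x$ be an $N\times N$ matrix of indeterminates and let $\mathcal A=R_\pi[x,\det(x)^{-1}]^{\widehat{\ }}$ ($p$-adic completion). A $\pi$-connection of degree $s$ is an $n$-tuple $(\phi_1^G,\dots,\phi_n^G)$ of higher $\pi$-Frobenius lifts of degree $s$ on $\mathcal A$ extending $\phi_1,\dots,\phi_n$. Write $\phi_i^G(a)=a^{p^s}+\pi\delta_i^G(a)$,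 $\Lambda_i=(x^{(p^s)})^{-1}\phi_i^G(x)$, $\Gamma_i^t=(x^{(p^s)})^{-1}\delta_i^G(x)$, $\Gamma^k_{ij}=(\Gamma_i)_{jk}$, and let $\phi_{i,0}^G$ be the endomorphism of $\mathcal A$ extending $\phi_i$ with $x\mapsto x^{(p^s)}$. Let $q\in\mathrm{GL}_N(R_\pi)$ be symmetric (a metric). The connection is *metric* for $q$ if $\phi_i^G\circ\mathcal H_q=\mathcal H_q\circ\phi_{i,0}^G$ for all $i$, where $\mathcal H_q:\mathcal A\to\mathcal A$ is the $R_\pi$-algebra map $x\mapsto x^tqx$; it is *$\mathcal B_q$-symmetric* if $(\phi_i^G\otimes\phi_{i,0}^G)\circ\mathcal B_q=(\phi_{i,0}^G\otimes\phi_i^G)\circ\mathcal B_q$ for all $i$, where $\mathcal B_q:\mathcal A\to\mathcal A\widehat\otimes_{R_\pi}\mathcal A$ is the $R_\pi$-algebra map $x\mapsto(x\otimes1)^tq(1\otimes x)$, and the maps $\mathcal A\widehat\otimes_{R_\pi}\mathcal A\to\mathcal A$ send $a\otimes b$ to $\phi_i^G(a)\phi_{i,0}^G(b)$ and to $\phi_{i,0}^G(a)\phi_i^G(b)$.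 The *arithmetic Chern connection* attached to $q$ is the unique $\pi$-connection of degree $s$ that is metric and $\mathcal B_q$-symmetric for $q$. If $N=n$, a torsion symbol over $S$ is an $n$-tuple $L=(L^1,\dots,L^n)$ of antisymmetric $n\times n$ matrices $L^k=(L^k_{ij})$ over $\widehat{S[y]}$, where $y=(y_1,\dots,y_n)$ are $n\times n$ matrices of indeterminates; for $S=R_\pi$ the *arithmetic Levi-Civita connection* attached to $q$ and $L$ is the unique $\pi$-connection of degree $s$ that is metric for $q$ and satisfies $\Gamma^k_{ij}-\Gamma^k_{ji}=L^k_{ij}(\Lambda_1,\dots,\Lambda_n)$ for all $i,j,k$. Let $\mathfrak T$ be a subgroup of the Galois group $\mathfrak G(K_\pi/K)$, identified with the group of $R$-algebra automorphisms of $R_\pi$, normalized by all $\phi_i$ (that is, $\phi_i\mathfrak T\phi_i^{-1}=\mathfrak T$). Let $\mathfrak W\subset\mathrm{GL}_N(R_\pi)$ be the subgroup generated by the permutation matrices and the diagonal matrices whose diagonal entries are roots of unity in $R$, with trivial $\mathfrak T$-action, so that $Z^1(\mathfrak T,\mathfrak W)=\mathrm{Hom}(\mathfrak T,\mathfrak W)$.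 Let $u\in Z^1(\mathfrak T,\mathfrak W)$, $\tau\mapsto u_\tau$. It is *$\Phi^{(s)}$-invariant* if $u_{\phi_i\tau\phi_i^{-1}}=u_\tau$ for all $i$ and $\tau$, and *compatible with $q$* if $\tau(q)=u_\tau^t\,q\,u_\tau$ for all $\tau$. For $\tau\in\mathfrak T$ let $\tau^G:\mathcal A\to\mathcal A$ be the ring endomorphism equal to $\tau$ on $R_\pi$ with $\tau^G(x)=u_\tau^{-1}x$, and let $\mathcal A^u\subset\mathcal A$ and $R_\pi^u\subset R_\pi$ be the subrings of elements fixed by all $\tau^G$, respectively by all $\tau$. The cocycle $u$ is *compatible with* a $\pi$-connection $(\phi_i^G)$ if $\phi_i^G\circ\tau^G=(\phi_i\tau\phi_i^{-1})^G\circ\phi_i^G$ for all $i$ and $\tau$. **Theorem.** Let $u\in Z^1(\mathfrak T,\mathfrak W)$ be $\Phi^{(s)}$-invariant and compatible with a metric $q\in\mathrm{GL}_N(R_\pi)^{\rm sym}$. 1) The arithmetic Chern connection attached to $q$ exists and is unique, and $u$ is compatible with it. 2) One has $\frac p\pi\in R_\pi$. If $N=n$ and $L$ is a torsion symbol over $R$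 (entries in $\widehat{R[y]}$), then the arithmetic Levi-Civita connection attached to $q$ and $\frac p\pi L$ exists and is unique, and $u$ is compatible with it. Hence each of these connections descends to the "torsor" $\mathcal A^u$: for every $i$, $\phi_i^G$ maps $\mathcal A^u$ into itself, and the induced endomorphism of $\mathcal A^u$ is congruent to the $p^s$-power map modulo $\pi\mathcal A$ and is compatible with the endomorphism of $R_\pi^u$ induced by $\phi_i$. -/

import Mathlib

open scoped TensorProduct Matrix

namespace ArithGeom

noncomputable section

/-! ## `p`-adic completions and ring maps between them -/

section Completion

variable (p : ℕ)

/-- The `p`-adic completion of a commutative ring. -/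
abbrev PComp (S : Type*) [CommRing S] : Type _ :=
  AdicCompletion (Ideal.span {(p : S)}) S

variable {p} {S T : Type*} [CommRing S] [CommRing T]

theorem evalHom_pow_mem (f : S →+* PComp p T) (m : ℕ) (a : S)
    (ha : a ∈ Ideal.span {(p : S)} ^ m) :
    ((AdicCompletion.evalₐ (Ideal.span {(p : T)}) m).toRingHom.comp f) a = 0 := by
  rw [Ideal.span_singleton_pow, Ideal.mem_span_singleton] at ha
  obtain ⟨b, rfl⟩ := ha
  have h : (Ideal.Quotient.mk (Ideal.span {(p : T)} ^ m)) ((p : T) ^ m) = 0 := by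
    rw [Ideal.Quotient.eq_zero_iff_mem, Ideal.span_singleton_pow]
    exact Ideal.mem_span_singleton_self _
  rw [map_mul, map_pow, map_natCast]
  rw [map_pow, map_natCast] at h
  rw [h, zero_mul]

/-- The map `S / p ^ m → T / p ^ m` induced by a ring map from `S` to the completion of `T`. -/
def quotMap (f : S →+* PComp p T) (m : ℕ) :
    S ⧸ Ideal.span {(p : S)} ^ m →+* T ⧸ Ideal.span {(p : T)} ^ m :=
  Ideal.Quotient.lift _
    ((AdicCompletion.evalₐ (Ideal.span {(p : T)}) m).toRingHom.comp f)
    (evalHom_pow_mem f m)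

theorem factor_evalHom {m l : ℕ} (hml : m ≤ l) (y : PComp p T) :
    Ideal.Quotient.factorPow (Ideal.span {(p : T)}) hml
      (AdicCompletion.evalₐ (Ideal.span {(p : T)}) l y) =
      AdicCompletion.evalₐ (Ideal.span {(p : T)}) m y := by
  induction y using AdicCompletion.induction_on with
  | h y =>
    simp only [AdicCompletion.evalₐ_mk]
    exact AdicCompletion.Ideal.mk_eq_mk _ hml y

theorem quotMap_compat (f : S →+* PComp p T) {m l : ℕ} (hml : m ≤ l) :
    (Ideal.Quotient.factorPow (Ideal.span {(p : T)}) hml).comp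
      ((quotMap f l).comp
        (AdicCompletion.evalₐ (Ideal.span {(p : S)}) l).toRingHom) =
      (quotMap f m).comp
        (AdicCompletion.evalₐ (Ideal.span {(p : S)}) m).toRingHom := by
  ext y
  induction y using AdicCompletion.induction_on with
  | h y =>
    simp only [RingHom.comp_apply, AlgHom.toRingHom_eq_coe, RingHom.coe_coe,
      AdicCompletion.evalₐ_mk, quotMap, Ideal.Quotient.lift_mk]
    rw [factor_evalHom hml, ← sub_eq_zero, ← map_sub, ← map_sub]
    refine evalHom_pow_mem f m _ ?_
    rw [← Ideal.Quotient.eq_zero_iff_mem, map_sub, sub_eq_zero]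
    exact AdicCompletion.Ideal.mk_eq_mk _ hml y

/-- The unique extension to the `p`-adic completion of `S` of a ring map from `S` to a
`p`-adic completion. -/
def PComp.lift (f : S →+* PComp p T) : PComp p S →+* PComp p T :=
  AdicCompletion.liftRingHom _
    (fun m => (quotMap f m).comp
      (AdicCompletion.evalₐ (Ideal.span {(p : S)}) m).toRingHom)
    (quotMap_compat f)

theorem PComp.lift_algebraMap (f : S →+* PComp p T) (a : S) :
    PComp.lift f (algebraMap S (PComp p S) a) = f a := by
  refine AdicCompletion.ext_evalₐ fun m => ?_
  rw [PComp.lift, AdicCompletion.evalₐ_liftRingHom]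
  simp [quotMap, AdicCompletion.algebraMap_apply]

/-- The map of `p`-adic completions induced by a ring map. -/
def PComp.map (f : S →+* T) : PComp p S →+* PComp p T :=
  PComp.lift ((algebraMap T (PComp p T)).comp f)

theorem PComp.isUnit_of_sub_dvd {a b : PComp p S} (hb : IsUnit b)
    (h : (p : PComp p S) ∣ a - b) : IsUnit a := by
  have hI : IsAdicComplete ((Ideal.span {(p : S)}).map (algebraMap S (PComp p S)))
      (PComp p S) :=
    (IsAdicComplete.map_algebraMap_iff _ _).mpr
      (AdicCompletion.isAdicComplete ⟨{(p : S)}, by simp⟩)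
  obtain ⟨c, hc⟩ := h
  obtain ⟨v, rfl⟩ := hb
  have hp : (p : PComp p S) * (c * ((v⁻¹ : (PComp p S)ˣ) : PComp p S)) ∈
      (⊥ : Ideal (PComp p S)).jacobson := by
    refine hI.le_jacobson_bot _ (Ideal.mul_mem_right _ _ ?_)
    have := Ideal.mem_map_of_mem (algebraMap S (PComp p S))
      (Ideal.mem_span_singleton_self (p : S))
    simpa using this
  have h1 := (Ideal.mem_jacobson_bot.mp hp) 1
  have h2 : a = ((p : PComp p S) * (c * ((v⁻¹ : (PComp p S)ˣ) : PComp p S)) * 1 + 1) * v := by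
    have : a = p * c + v := by rw [← hc]; ring
    rw [this, mul_one, add_mul, one_mul, mul_assoc, mul_assoc, Units.inv_mul, mul_one]
  rw [h2]
  exact h1.mul v.isUnit

end Completion

/-- The ring map `B ⊗[S] C → D` given by two ring maps that agree on `S`. -/
def tensorLift {S B C D : Type*} [CommRing S] [CommRing B] [CommRing C] [CommRing D]
    [Algebra S B] [Algebra S C] (f : B →+* D) (g : C →+* D)
    (h : f.comp (algebraMap S B) = g.comp (algebraMap S C)) : B ⊗[S] C →+* D :=
  letI : Algebra S D := (f.comp (algebraMap S B)).toAlgebra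
  (Algebra.TensorProduct.lift
    { f with commutes' := fun _ => rfl }
    { g with commutes' := fun a => (congrArg (fun e : S →+* D => e a) h).symm }
    (fun _ _ => Commute.all _ _) : B ⊗[S] C →ₐ[S] D).toRingHom

/-! ## The coordinate ring of `GL_N` and its `p`-adic completion -/

section GLRing

/-- `S[x, det(x)⁻¹]`, where `x` is an `N × N` matrix of indeterminates. -/
abbrev CoordRing (S : Type*) [CommRing S] (N : ℕ) : Type _ :=
  Localization.Away (Matrix.mvPolynomialX (Fin N) (Fin N) S).det

/-- The `p`-adic completion of `S[x, det(x)⁻¹]`. -/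
abbrev GLComp (p : ℕ) (S : Type*) [CommRing S] (N : ℕ) : Type _ :=
  PComp p (CoordRing S N)

variable (p : ℕ) {S : Type*} [CommRing S] (N : ℕ)

/-- The matrix `x` over `S[x, det(x)⁻¹]`. -/
def coordMatrix : Matrix (Fin N) (Fin N) (CoordRing S N) :=
  (Matrix.mvPolynomialX (Fin N) (Fin N) S).map (algebraMap _ (CoordRing S N))

theorem isUnit_det_coordMatrix : IsUnit (coordMatrix (S := S) N).det := by
  have h : (coordMatrix (S := S) N).det =
      algebraMap _ (CoordRing S N) (Matrix.mvPolynomialX (Fin N) (Fin N) S).det :=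
    (RingHom.map_det _ _).symm
  rw [h]
  exact IsLocalization.Away.algebraMap_isUnit _

/-- The matrix `x` over the completed coordinate ring. -/
def genX : GL (Fin N) (GLComp p S N) :=
  Matrix.GeneralLinearGroup.map (algebraMap (CoordRing S N) (GLComp p S N))
    (Matrix.GeneralLinearGroup.mk'' (coordMatrix N) (isUnit_det_coordMatrix N))

variable {p N}

/-- The ring map `S[x, det(x)⁻¹] → D` that is `f` on `S` and sends `x` to `M`. -/
def coordEval {D : Type*} [CommRing D] (f : S →+* D) (M : GL (Fin N) D) :
    CoordRing S N →+* D :=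
  IsLocalization.Away.lift (Matrix.mvPolynomialX (Fin N) (Fin N) S).det
    (g := MvPolynomial.eval₂Hom f fun ab : Fin N × Fin N => M.val ab.1 ab.2) (by
      rw [RingHom.map_det]
      have h : (MvPolynomial.eval₂Hom f fun ab : Fin N × Fin N => M.val ab.1 ab.2).mapMatrix
          (Matrix.mvPolynomialX (Fin N) (Fin N) S) = M.val := by
        ext a b
        simp [Matrix.mvPolynomialX]
      rw [h]
      exact (Matrix.isUnit_iff_isUnit_det _).mp M.isUnit)

/-- The ring map from the completed coordinate ring of `GL_N` to a `p`-adic completion that is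
`f` on `S` and sends `x` to `M`. -/
def glEval {T : Type*} [CommRing T] (f : S →+* PComp p T) (M : GL (Fin N) (PComp p T)) :
    GLComp p S N →+* PComp p T :=
  PComp.lift (coordEval f M)

/-- The matrix `X^(q)` whose entries are the `q`-th powers of the entries of `X`. -/
def entryPow {D : Type*} [CommRing D] (X : Matrix (Fin N) (Fin N) D) (q : ℕ) :
    Matrix (Fin N) (Fin N) D :=
  X.map (· ^ q)

theorem dvd_det_entryPow_sub {D : Type*} [CommRing D] [Fact p.Prime]
    (X : Matrix (Fin N) (Fin N) D) (s : ℕ) :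
    (p : D) ∣ (entryPow X (p ^ s)).det - X.det ^ (p ^ s) := by
  rw [← Ideal.mem_span_singleton, ← Ideal.Quotient.eq_zero_iff_mem, map_sub, map_pow,
    sub_eq_zero, RingHom.map_det, RingHom.map_det]
  rcases subsingleton_or_nontrivial (D ⧸ Ideal.span {(p : D)}) with hQ | hQ
  · exact Subsingleton.elim _ _
  · have h0 : ((p : ℕ) : D ⧸ Ideal.span {(p : D)}) = 0 := by
      rw [← map_natCast (Ideal.Quotient.mk (Ideal.span {(p : D)})),
        Ideal.Quotient.eq_zero_iff_mem]
      exact Ideal.mem_span_singleton_self _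
    have : CharP (D ⧸ Ideal.span {(p : D)}) p :=
      (CharP.charP_iff_prime_eq_zero Fact.out).mpr h0
    rw [← iterateFrobenius_def p s, RingHom.map_det]
    congr 1

variable (p N) in
/-- The invertible matrix `x^(p ^ s)` over the completed coordinate ring. -/
def genXPow [Fact p.Prime] (s : ℕ) : GL (Fin N) (GLComp p S N) :=
  Matrix.GeneralLinearGroup.mk'' (entryPow (genX p N).val (p ^ s))
    (PComp.isUnit_of_sub_dvd
      (((Matrix.isUnit_iff_isUnit_det _).mp (genX p N).isUnit).pow (p ^ s))
      (dvd_det_entryPow_sub _ s))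

variable (p N) in
/-- A matrix with entries in `S`, viewed over the completed coordinate ring. -/
def constGL (q : GL (Fin N) S) : GL (Fin N) (GLComp p S N) :=
  Matrix.GeneralLinearGroup.map (algebraMap S (GLComp p S N)) q

/-- The transpose of an invertible matrix. -/
def glTranspose {D : Type*} [CommRing D] (X : GL (Fin N) D) : GL (Fin N) D :=
  Matrix.GeneralLinearGroup.mk'' X.valᵀ (by
    rw [Matrix.det_transpose]
    exact (Matrix.isUnit_iff_isUnit_det _).mp X.isUnit)

end GLRing

/-! ## `π`-connections -/

/-- A higher `ϖ`-Frobenius lift of degree `s`: a ring endomorphism reducing to the `p ^ s`-power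
map modulo `ϖ`. -/
def IsFrobLift (p s : ℕ) {S : Type*} [CommRing S] (ϖ : S) (φ : S →+* S) : Prop :=
  ∀ a, ϖ ∣ φ a - a ^ p ^ s

/-- A `ϖ`-connection of degree `s` on `GL_N` over `S`: an `n`-tuple of higher `ϖ`-Frobenius lifts
of degree `s` on the completed coordinate ring, extending the given endomorphisms of `S`. -/
@[ext]
structure PiConnection (p s : ℕ) {S : Type*} [CommRing S] (ϖ : S) {n : ℕ} (φ : Fin n → S →+* S)
    (N : ℕ) where
  /-- The Frobenius lifts on the completed coordinate ring. -/
  lift : Fin n → GLComp p S N →+* GLComp p S N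
  isFrobLift : ∀ i, IsFrobLift p s (algebraMap S (GLComp p S N) ϖ) (lift i)
  extends_base : ∀ i, (lift i).comp (algebraMap S (GLComp p S N)) =
    (algebraMap S (GLComp p S N)).comp (φ i)

/-- The endomorphism of the completed coordinate ring that extends `φ` and sends `x`
to `x^(p ^ s)`. -/
def trivialLift (p s : ℕ) [Fact p.Prime] {S : Type*} [CommRing S] (φ : S →+* S) (N : ℕ) :
    GLComp p S N →+* GLComp p S N :=
  glEval ((algebraMap S (GLComp p S N)).comp φ) (genXPow p N s)

theorem coordEval_algebraMap {D : Type*} [CommRing D] {S : Type*} [CommRing S] {N : ℕ}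
    (f : S →+* D) (M : GL (Fin N) D) (a : S) :
    coordEval f M (algebraMap S (CoordRing S N) a) = f a := by
  rw [IsScalarTower.algebraMap_apply S (MvPolynomial (Fin N × Fin N) S) (CoordRing S N),
    coordEval, IsLocalization.Away.lift_eq]
  simp

theorem trivialLift_comp (p s : ℕ) [Fact p.Prime] {S : Type*} [CommRing S] (φ : S →+* S)
    (N : ℕ) :
    (trivialLift p s φ N).comp (algebraMap S (GLComp p S N)) =
      (algebraMap S (GLComp p S N)).comp φ := by
  ext1 a
  rw [RingHom.comp_apply, IsScalarTower.algebraMap_apply S (CoordRing S N) (GLComp p S N),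
    trivialLift, glEval, PComp.lift_algebraMap, coordEval_algebraMap]

section Metric

variable (p : ℕ) {S : Type*} [CommRing S] {N : ℕ}

/-- The `S`-algebra endomorphism of the completed coordinate ring with `x ↦ xᵗ q x`. -/
def metricMap (q : GL (Fin N) S) : GLComp p S N →+* GLComp p S N :=
  glEval (algebraMap S (GLComp p S N)) (glTranspose (genX p N) * constGL p N q * genX p N)

/-- The completed tensor square of the completed coordinate ring. -/
abbrev GLComp₂ (S : Type*) [CommRing S] (N : ℕ) : Type _ :=
  PComp p (GLComp p S N ⊗[S] GLComp p S N)

/-- The `S`-algebra map to the completed tensor square with `x ↦ x₁ᵗ q x₂`. -/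
def bilinMap (q : GL (Fin N) S) : GLComp p S N →+* GLComp₂ p S N :=
  glEval (algebraMap S (GLComp₂ p S N))
    (glTranspose (Matrix.GeneralLinearGroup.map
        ((algebraMap (GLComp p S N ⊗[S] GLComp p S N) (GLComp₂ p S N)).comp
          (Algebra.TensorProduct.includeLeftRingHom)) (genX p N)) *
      Matrix.GeneralLinearGroup.map (algebraMap S (GLComp₂ p S N)) q *
      Matrix.GeneralLinearGroup.map
        ((algebraMap (GLComp p S N ⊗[S] GLComp p S N) (GLComp₂ p S N)).comp
          (Algebra.TensorProduct.includeRight :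
            GLComp p S N →ₐ[S] GLComp p S N ⊗[S] GLComp p S N).toRingHom) (genX p N))

variable {p}

/-- For endomorphisms `f`, `g` of the completed coordinate ring that agree on `S`, the map
`a ⊗ b ↦ f a * g b` on the completed tensor square. -/
def tensorMap (f g : GLComp p S N →+* GLComp p S N)
    (h : f.comp (algebraMap S (GLComp p S N)) = g.comp (algebraMap S (GLComp p S N))) :
    GLComp₂ p S N →+* GLComp p S N :=
  PComp.lift (tensorLift f g h)

end Metric

namespace PiConnection

variable {p s : ℕ} {S : Type*} [CommRing S] {ϖ : S} {n : ℕ} {φ : Fin n → S →+* S} {N : ℕ}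

/-- The matrix `Λ_i = (x^(p ^ s))⁻¹ φ_i(x)`. -/
def Lam [Fact p.Prime] (D : PiConnection p s ϖ φ N) (i : Fin n) :
    Matrix (Fin N) (Fin N) (GLComp p S N) :=
  (genXPow p N s)⁻¹.val * (genX p N).val.map (D.lift i)

/-- The attached higher `ϖ`-derivation, `φ_i(a) = a ^ (p ^ s) + ϖ δ_i(a)`. -/
def deriv (D : PiConnection p s ϖ φ N) (i : Fin n) (a : GLComp p S N) : GLComp p S N :=
  (D.isFrobLift i a).choose

/-- The Christoffel symbols of the second kind, `Γ_iᵗ = (x^(p ^ s))⁻¹ δ_i(x)`. -/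
def Gam [Fact p.Prime] (D : PiConnection p s ϖ φ N) (i : Fin n) :
    Matrix (Fin N) (Fin N) (GLComp p S N) :=
  ((genXPow p N s)⁻¹.val * (genX p N).val.map (D.deriv i))ᵀ

/-- The connection is metric with respect to `q`: `φ_i ∘ H_q = H_q ∘ φ_{i,0}`. -/
def IsMetric [Fact p.Prime] (D : PiConnection p s ϖ φ N) (q : GL (Fin N) S) : Prop :=
  ∀ i, (D.lift i).comp (metricMap p q) = (metricMap p q).comp (trivialLift p s (φ i) N)

/-- The connection is `B_q`-symmetric: `(φ_i ⊗ φ_{i,0}) ∘ B_q = (φ_{i,0} ⊗ φ_i) ∘ B_q`. -/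
def IsBilinSymmetric [Fact p.Prime] (D : PiConnection p s ϖ φ N) (q : GL (Fin N) S) : Prop :=
  ∀ i,
    (tensorMap (D.lift i) (trivialLift p s (φ i) N)
      ((D.extends_base i).trans (trivialLift_comp p s (φ i) N).symm)).comp (bilinMap p q) =
    (tensorMap (trivialLift p s (φ i) N) (D.lift i)
      ((trivialLift_comp p s (φ i) N).trans (D.extends_base i).symm)).comp (bilinMap p q)

/-- The connection is the arithmetic Chern connection attached to `q`. -/
def IsChern [Fact p.Prime] (D : PiConnection p s ϖ φ N) (q : GL (Fin N) S) : Prop :=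
  D.IsBilinSymmetric q ∧ D.IsMetric q

end PiConnection

/-! ## Torsion symbols -/

/-- The `p`-adic completion of `S[y]`, where `y = (y_1, …, y_n)` is an `n`-tuple of `n × n`
matrices of indeterminates; the indeterminate `(m, a, b)` is the entry `(y_m)_{ab}`. -/
abbrev YComp (p : ℕ) (S : Type*) [CommRing S] (n : ℕ) : Type _ :=
  PComp p (MvPolynomial (Fin n × Fin n × Fin n) S)

/-- A torsion symbol: an `n`-tuple of antisymmetric `n × n` matrices `L^k = (L^k_{ij})` with
entries in the `p`-adic completion of `S[y]`. -/
structure TorsionSymbol (p : ℕ) (S : Type*) [CommRing S] (n : ℕ) where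
  /-- The matrices `L^k`. -/
  mat : Fin n → Matrix (Fin n) (Fin n) (YComp p S n)
  antisymm : ∀ k, (mat k)ᵀ = -mat k

namespace TorsionSymbol

variable {p : ℕ} {S : Type*} [CommRing S] {n : ℕ}

/-- The image of a torsion symbol over `R` in the torsion symbols over an `R`-algebra. -/
def baseChange {R : Type*} [CommRing R] (L : TorsionSymbol p R n) (S : Type*) [CommRing S]
    [Algebra R S] : TorsionSymbol p S n where
  mat k := (L.mat k).map (PComp.map (MvPolynomial.map (algebraMap R S)))
  antisymm k := by
    rw [← Matrix.transpose_map, L.antisymm]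
    ext a b
    simp

/-- The product of a torsion symbol by a scalar. -/
def scale (c : S) (L : TorsionSymbol p S n) : TorsionSymbol p S n where
  mat k := algebraMap S (YComp p S n) c • L.mat k
  antisymm k := by rw [Matrix.transpose_smul, L.antisymm, smul_neg]

end TorsionSymbol

/-- The evaluation `F ↦ F(Y)` at an `n`-tuple `Y` of `n × n` matrices. -/
def evalY {p : ℕ} {S : Type*} [CommRing S] {n : ℕ}
    (Y : Fin n → Matrix (Fin n) (Fin n) (GLComp p S n)) : YComp p S n →+* GLComp p S n :=
  PComp.lift (MvPolynomial.eval₂Hom (algebraMap S (GLComp p S n))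
    fun mab : Fin n × Fin n × Fin n => Y mab.1 mab.2.1 mab.2.2)

namespace PiConnection

variable {p s : ℕ} [Fact p.Prime] {S : Type*} [CommRing S] {ϖ : S} {n : ℕ}
  {φ : Fin n → S →+* S}

/-- The connection is symmetric with respect to `L`:
`Γ^k_{ij} - Γ^k_{ji} = L^k_{ij}(Λ)`, where `Γ^k_{ij} = (Γ_i)_{jk}`. -/
def IsSymmetric (D : PiConnection p s ϖ φ n) (L : TorsionSymbol p S n) : Prop :=
  ∀ i j k, D.Gam i j k - D.Gam j i k = evalY D.Lam (L.mat k i j)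

/-- The connection is the arithmetic Levi-Civita connection attached to `q` and `L`. -/
def IsLeviCivita (D : PiConnection p s ϖ φ n) (q : GL (Fin n) S) (L : TorsionSymbol p S n) :
    Prop :=
  D.IsMetric q ∧ D.IsSymmetric L

end PiConnection

/-! ## The gauge group, cocycles and their compatibilities -/

/-- The subgroup of `GL_N(S)` generated by the permutation matrices and by the diagonal matrices
whose diagonal entries are roots of unity in `R`. -/
def gaugeGroup (R : Type*) {S : Type*} [CommRing R] [CommRing S] [Algebra R S] (N : ℕ) :
    Subgroup (GL (Fin N) S) :=
  Subgroup.closure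
    ({g | ∃ σ : Equiv.Perm (Fin N), g.val = σ.permMatrix S} ∪
      {g | ∃ d : Fin N → R, (∀ a, IsOfFinOrder (d a)) ∧
        g.val = Matrix.diagonal fun a => algebraMap R S (d a)})

section Cocycle

variable {R S : Type*} [CommRing R] [CommRing S] [Algebra R S]

/-- `τ' = φ τ φ⁻¹`, written as `φ τ = τ' φ`. -/
def IsConjBy (φ : S →+* S) (τ τ' : S ≃ₐ[R] S) : Prop :=
  ∀ a, φ (τ a) = τ' (φ a)

/-- `φ` normalizes the group `T` of automorphisms, i.e. `φ T φ⁻¹ = T`. -/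
def Normalizes (φ : S →+* S) (T : Subgroup (S ≃ₐ[R] S)) : Prop :=
  (∀ τ ∈ T, ∃ τ' ∈ T, IsConjBy φ τ τ') ∧ ∀ τ' ∈ T, ∃ τ ∈ T, IsConjBy φ τ τ'

variable {T : Subgroup (S ≃ₐ[R] S)} {N n : ℕ}

/-- The cocycle `u` (a homomorphism, as `T` acts trivially on the gauge group) is `Φ`-invariant:
`u(φ_i τ φ_i⁻¹) = u(τ)`. -/
def IsInvariantCocycle (φ : Fin n → S →+* S) (u : T →* gaugeGroup R (S := S) N) : Prop :=
  ∀ i, ∀ τ τ' : T, IsConjBy (φ i) τ.1 τ'.1 → u τ' = u τ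

/-- The cocycle is compatible with `q`: `τ(q) = u(τ)ᵗ q u(τ)`. -/
def IsCompatibleMetric (u : T →* gaugeGroup R (S := S) N) (q : GL (Fin N) S) : Prop :=
  ∀ τ : T, q.val.map τ.1 = (u τ).1.valᵀ * q.val * (u τ).1.val

variable (p : ℕ)

/-- The action of `τ` on the completed coordinate ring given by the cocycle `u`: it is `τ`
on `S` and sends `x` to `u(τ)⁻¹ x`. -/
def twistedAction (u : T →* gaugeGroup R (S := S) N) (τ : T) :
    GLComp p S N →+* GLComp p S N :=
  glEval ((algebraMap S (GLComp p S N)).comp (τ.1 : S →+* S))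
    (constGL p N ((u τ).1⁻¹) * genX p N)

/-- The ring of invariants of the action given by `u`. -/
def torsorRing (u : T →* gaugeGroup R (S := S) N) : Subring (GLComp p S N) :=
  ⨅ τ : T, RingHom.eqLocus (twistedAction p u τ) (RingHom.id _)

variable (T) in
/-- The ring of `T`-invariants in `S`. -/
def baseInvariants : Subring S :=
  ⨅ τ : T, RingHom.eqLocus (τ.1 : S →+* S) (RingHom.id _)

variable {p} {s : ℕ} {ϖ : S} {φ : Fin n → S →+* S}

/-- The cocycle `u` is compatible with the connection: `φ_i^G ∘ τ^G = (φ_i τ φ_i⁻¹)^G ∘ φ_i^G`. -/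
def IsCompatibleConnection (u : T →* gaugeGroup R (S := S) N) (D : PiConnection p s ϖ φ N) :
    Prop :=
  ∀ i, ∀ τ τ' : T, IsConjBy (φ i) τ.1 τ'.1 →
    (D.lift i).comp (twistedAction p u τ) = (twistedAction p u τ').comp (D.lift i)

/-- The connection descends to the torsor attached to `u`: each of its Frobenius lifts restricts
to a ring endomorphism of the ring of invariants, which is congruent to the `p ^ s`-power map
modulo `ϖ` and restricts on the `T`-invariants of `S` to an endomorphism induced by `φ_i`. -/
def DescendsToTorsor (D : PiConnection p s ϖ φ N) (u : T →* gaugeGroup R (S := S) N) : Prop :=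
  ∀ i, ∃ (ψ : torsorRing p u →+* torsorRing p u)
      (ψ₀ : baseInvariants T →+* baseInvariants T),
    (∀ f, (ψ f : GLComp p S N) = D.lift i f) ∧
    (∀ a, (ψ₀ a : S) = φ i a) ∧
    (∀ f, algebraMap S (GLComp p S N) ϖ ∣ (ψ f : GLComp p S N) - (f : GLComp p S N) ^ p ^ s) ∧
    ∀ a : baseInvariants T, ∀ f : torsorRing p u,
      (f : GLComp p S N) = algebraMap S (GLComp p S N) a →
        (ψ f : GLComp p S N) = algebraMap S (GLComp p S N) (ψ₀ a)

end Cocycle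

/-! ## The local field setting -/

section LocalSetting

variable (p : ℕ) [Fact p.Prime]

/-- The `p`-adic completion of the maximal unramified extension of `ℤ_p`, as the ring of Witt
vectors of an algebraic closure of `𝔽_p`. -/
abbrev UnramRing : Type :=
  WittVector p (AlgebraicClosure (ZMod p))

/-- The fraction field of `UnramRing p`. -/
abbrev UnramField : Type :=
  FractionRing (UnramRing p)

/-- An algebraic closure of `UnramField p`. -/
abbrev UnramClosure : Type :=
  AlgebraicClosure (UnramField p)

/-- The embedding of `ℤ_p`, the Witt vectors of `𝔽_p`, into `UnramRing p`. -/
def padicIntEmb : ℤ_[p] →+* UnramRing p :=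
  (WittVector.map (algebraMap (ZMod p) (AlgebraicClosure (ZMod p)))).comp
    (WittVector.equiv p).symm.toRingHom

theorem padicIntEmb_injective : Function.Injective (padicIntEmb p) := by
  rw [padicIntEmb, RingHom.coe_comp]
  exact (WittVector.map_injective _
    (algebraMap (ZMod p) (AlgebraicClosure (ZMod p))).injective).comp
    (WittVector.equiv p).symm.injective

/-- The resulting embedding of `ℚ_p` into `UnramField p`. -/
def padicEmb : ℚ_[p] →+* UnramField p :=
  IsFractionRing.lift (A := ℤ_[p])
    (g := (algebraMap (UnramRing p) (UnramField p)).comp (padicIntEmb p))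
    ((IsFractionRing.injective (UnramRing p) (UnramField p)).comp (padicIntEmb_injective p))

instance : Algebra ℤ_[p] (UnramRing p) :=
  (padicIntEmb p).toAlgebra

instance : Algebra ℚ_[p] (UnramField p) :=
  (padicEmb p).toAlgebra

instance : IsScalarTower ℤ_[p] ℚ_[p] (UnramField p) :=
  IsScalarTower.of_algebraMap_eq fun a =>
    (IsFractionRing.lift_algebraMap (A := ℤ_[p]) (K := ℚ_[p])
      (g := (algebraMap (UnramRing p) (UnramField p)).comp (padicIntEmb p))
      ((IsFractionRing.injective (UnramRing p) (UnramField p)).comp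
        (padicIntEmb_injective p)) a).symm

variable {p}

/-- `π` is a prime element of (the valuation ring, i.e. the integral closure of `ℤ_p`, of) some
finite Galois extension of `ℚ_p`. -/
def IsGaloisPrimeElement (π : UnramClosure p) : Prop :=
  ∃ E : IntermediateField ℚ_[p] (UnramClosure p),
    FiniteDimensional ℚ_[p] E ∧ IsGalois ℚ_[p] E ∧
      ∃ ϖ : integralClosure ℤ_[p] E, Prime ϖ ∧ ((ϖ : E) : UnramClosure p) = π

/-- The ring `R_π = R[π]`. -/
abbrev RamRing (π : UnramClosure p) : Subalgebra (UnramRing p) (UnramClosure p) :=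
  Algebra.adjoin (UnramRing p) {π}

/-- The element `π` of `R_π`. -/
def RamRing.unif (π : UnramClosure p) : RamRing π :=
  ⟨π, Algebra.subset_adjoin rfl⟩

end LocalSetting

end

end ArithGeom

open ArithGeom

set_option linter.unusedSectionVars false

/-! A connection is the same thing as a tuple of matrices `Λ_i ≡ 1` mod `π`: such a matrix is
automatically invertible, and `x ↦ x^(p^s) Λ_i` defines a Frobenius lift because it does so modulo
`π` on generators. Put `A_i = (x^(p^s))ᵗ φ_i(q) x^(p^s)` and `B = (xᵗ q x)^(p^s)`, two symmetric
invertible matrices that are congruent mod `π`. Evaluating at `x` turns "metric" into `Λ_iᵗ A_i Λ_i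
= B` and "`B_q`-symmetric" into `Λ_iᵗ A_i = A_i Λ_i`.

Chern: together the two equations say `Λ_i² = A_i⁻¹ B`, together with the symmetry of `A_i Λ_i`. As
2 is invertible, a matrix congruent to 1 has exactly one square root congruent to 1. The symmetry
then comes for free, since `A_i⁻¹ Λ_iᵗ A_i` is another such root (`existsUnique_chern`).

Levi-Civita: write `Λ_i = 1 + π M_i`. The metric equation prescribes the symmetric part of `B M_i`
up to terms divisible by `π` in `M_i`, and the torsion equation prescribes the part of `B M_i`
antisymmetric in two indices, again with a `π`-small dependence on `M`. The Koszul formula inverts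
this linear system, and what remains is a fixed point problem for a `π`-adic contraction
(`existsUnique_leviCivita`).

Compatibility follows from uniqueness. The map `τ^G` fixes `B` because `u` is compatible with `q`.
It fixes `A_i` because elements of the gauge group are compatible with entrywise powers and `φ_i`
raises roots of unity of `R` to the power `p^s`, so that `x^(p^s)` goes to `φ_i(u⁻¹) x^(p^s)`. In
the torsion equation the coefficient `π · (p/π) = p` and the coefficients of `L` are fixed as well.
Hence `τ^G(Λ)` solves the same system as `Λ`, so `τ^G(Λ) = Λ`, which gives the commutation relation
and the descent.

Four facts about `R[π]` feed this: `π` divides `p`, `p` divides a power of `π`, `π` divides `τ(π)`,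
and `φ_i(ζ) = ζ^(p^s)` for roots of unity `ζ` of `R`. The first two hold in the ring of integers of
`E`, which lies in `R[π]`: its Teichmüller elements lie in `R`, and Nakayama's lemma does the rest
(`coe_integralClosure_mem_ramRing`). The last uses that `p` is odd, so that roots of unity of `R`
have order prime to `p`. -/

namespace ArithGeom

/-! ### Completions: density, torsion and a contraction principle. -/

section PCompFacts

variable {p : ℕ} {S T : Type*} [CommRing S] [CommRing T]

theorem PComp.isAdicComplete : IsAdicComplete (Ideal.span {(p : PComp p S)}) (PComp p S) := by
  have hI : IsAdicComplete ((Ideal.span {(p : S)}).map (algebraMap S (PComp p S)))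
      (PComp p S) :=
    (IsAdicComplete.map_algebraMap_iff _ _).mpr
      (AdicCompletion.isAdicComplete ⟨{(p : S)}, by simp⟩)
  simpa [Ideal.map_span] using hI

theorem PComp.eq_zero_of_forall_dvd {y : PComp p S} (h : ∀ m : ℕ, (p : PComp p S) ^ m ∣ y) :
    y = 0 := by
  refine PComp.isAdicComplete.toIsHausdorff.haus y fun m => ?_
  rw [SModEq.zero, smul_eq_mul, Ideal.mul_top, Ideal.span_singleton_pow,
    Ideal.mem_span_singleton]
  exact h m

theorem PComp.exists_approx (y : PComp p S) (m : ℕ) :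
    ∃ a : S, (p : PComp p S) ^ m ∣ y - algebraMap S (PComp p S) a := by
  have h := AdicCompletion.pow_smul_top_eq_ker_eval (I := Ideal.span {(p : S)}) (M := S) (n := m)
    ⟨{(p : S)}, by simp⟩
  obtain ⟨a, ha⟩ := Submodule.mkQ_surjective _ (AdicCompletion.eval (Ideal.span {(p : S)}) S m y)
  refine ⟨a, ?_⟩
  have h2 : y - algebraMap S (PComp p S) a ∈
      (AdicCompletion.eval (Ideal.span {(p : S)}) S m).ker := by
    rw [LinearMap.mem_ker, map_sub, ← ha, sub_eq_zero]
    rfl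
  rw [← h] at h2
  refine Submodule.smul_induction_on h2 (fun r hr b _ => ?_) fun _ _ => dvd_add
  rw [Ideal.span_singleton_pow, Ideal.mem_span_singleton] at hr
  rw [Algebra.smul_def]
  exact Dvd.dvd.mul_right (by simpa using map_dvd (algebraMap S (PComp p S)) hr) _

/-- Modulo `p^m` every element of the completion comes from `S`, and ring maps preserve `p^m`. So no
continuity of `f` and `g` has to be assumed. -/
theorem PComp.hom_congr {B : Type*} [CommRing B] {J : Ideal B} {m : ℕ} (hm : (p : B) ^ m ∈ J)
    {f g : PComp p S →+* B}
    (h : ∀ a, f (algebraMap S (PComp p S) a) - g (algebraMap S (PComp p S) a) ∈ J) (y : PComp p S) :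
    f y - g y ∈ J := by
  obtain ⟨a, b, hb⟩ := PComp.exists_approx y m
  obtain rfl : y = algebraMap S (PComp p S) a + (p : PComp p S) ^ m * b := by rw [← hb]; ring
  have : f (algebraMap S (PComp p S) a + p ^ m * b) - g (algebraMap S (PComp p S) a + p ^ m * b) =
      (f (algebraMap S (PComp p S) a) - g (algebraMap S (PComp p S) a)) +
        (p : B) ^ m * (f b - g b) := by
    simp only [map_add, map_mul, map_pow, map_natCast]; ring
  rw [this]
  exact J.add_mem (h a) (J.mul_mem_right _ hm)

theorem PComp.hom_ext {f g : PComp p S →+* PComp p T}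
    (h : f.comp (algebraMap S (PComp p S)) = g.comp (algebraMap S (PComp p S))) : f = g := by
  ext1 y
  rw [← sub_eq_zero]
  refine PComp.eq_zero_of_forall_dvd fun m => ?_
  rw [← Ideal.mem_span_singleton]
  refine PComp.hom_congr (m := m) (Ideal.mem_span_singleton_self _) (fun a => ?_) y
  have := congrArg (fun e : S →+* PComp p T => e a) h
  simp only [RingHom.comp_apply] at this
  rw [this, sub_self]
  exact zero_mem _

theorem PComp.eq_zero_of_natCast_mul (hS : ∀ a : S, (p : S) * a = 0 → a = 0) {y : PComp p S}
    (hy : (p : PComp p S) * y = 0) : y = 0 := by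
  refine AdicCompletion.ext_evalₐ fun m => ?_
  induction y using AdicCompletion.induction_on with
  | h y =>
    have h1 := congrArg (AdicCompletion.evalₐ (Ideal.span {(p : S)}) (m + 1)) hy
    rw [map_mul, map_natCast, map_zero, AdicCompletion.evalₐ_mk,
      ← map_natCast (Ideal.Quotient.mk _), ← map_mul, Ideal.Quotient.eq_zero_iff_mem,
      Ideal.span_singleton_pow, Ideal.mem_span_singleton] at h1
    obtain ⟨b, hb⟩ := h1
    -- Cancelling `p` costs one level of precision, which is why the relation is read off at level
    -- `m + 1`.
    have h2 : y (m + 1) = (p : S) ^ m * b := by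
      rw [← sub_eq_zero]
      apply hS
      rw [mul_sub, hb]; ring
    rw [map_zero, AdicCompletion.evalₐ_mk, ← AdicCompletion.Ideal.mk_eq_mk _ m.le_succ y,
      Ideal.Quotient.eq_zero_iff_mem, Ideal.span_singleton_pow, Ideal.mem_span_singleton]
    exact ⟨b, h2⟩

theorem PComp.exists_limit (f : ℕ → PComp p S)
    (hf : ∀ m, (p : PComp p S) ^ m ∣ f (m + 1) - f m) :
    ∃ L, ∀ m, (p : PComp p S) ^ m ∣ L - f m := by
  have key : ∀ m k, (p : PComp p S) ^ m ∣ f (m + k) - f m := by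
    intro m k
    induction k with
    | zero => simp
    | succ k ih =>
      have := (pow_dvd_pow (p : PComp p S) (Nat.le_add_right m k)).trans (hf (m + k))
      have h := dvd_add this ih
      rwa [sub_add_sub_cancel] at h
  obtain ⟨L, hL⟩ := (PComp.isAdicComplete (p := p) (S := S)).toIsPrecomplete.prec (f := f) (by
    intro m n hmn
    obtain ⟨k, rfl⟩ := Nat.exists_eq_add_of_le hmn
    rw [SModEq.sub_mem, smul_eq_mul, Ideal.mul_top, Ideal.span_singleton_pow,
      Ideal.mem_span_singleton, dvd_sub_comm]
    exact key m k)
  refine ⟨L, fun m => ?_⟩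
  have := hL m
  rwa [SModEq.sub_mem, smul_eq_mul, Ideal.mul_top, Ideal.span_singleton_pow,
      Ideal.mem_span_singleton, dvd_sub_comm] at this

/-- A map on tuples of elements of a `p`-adic completion that is contracting for the `ϖ`-adic
topology, where `ϖ` divides `p` and `p` divides a power of `ϖ`, has exactly one fixed point. -/
theorem PComp.existsUnique_fixedPoint {ϖ : PComp p S} (h1 : ϖ ∣ (p : PComp p S)) {e : ℕ}
    (h2 : (p : PComp p S) ∣ ϖ ^ e) {X : Type*} (F : (X → PComp p S) → X → PComp p S)
    (hF : ∀ k f g, (∀ x, ϖ ^ k ∣ f x - g x) → ∀ x, ϖ ^ (k + 1) ∣ F f x - F g x) :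
    ∃! f, F f = f := by
  have hsep : ∀ y : PComp p S, (∀ k, ϖ ^ k ∣ y) → y = 0 := fun y hy =>
    PComp.eq_zero_of_forall_dvd fun m =>
      (pow_dvd_pow_of_dvd h2 m).trans (by rw [← pow_mul]; exact hy _)
  have hun : ∀ f g, F f = f → F g = g → f = g := by
    intro f g hf hg
    have : ∀ k x, ϖ ^ k ∣ f x - g x := by
      intro k
      induction k with
      | zero => simp
      | succ k ih => have := hF k f g ih; rwa [hf, hg] at this
    ext1 x
    exact sub_eq_zero.mp (hsep _ fun k => this k x)
  have hit : ∀ k x, ϖ ^ k ∣ F^[k + 1] 0 x - F^[k] 0 x := by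
    intro k
    induction k with
    | zero => simp
    | succ k ih =>
      simp only [Function.iterate_succ_apply' F] at ih ⊢
      exact hF k _ _ ih
  have hitadd : ∀ k j x, ϖ ^ k ∣ F^[k + j] 0 x - F^[k] 0 x := by
    intro k j x
    induction j with
    | zero => simp
    | succ j ih =>
      have := dvd_add ((pow_dvd_pow ϖ (Nat.le_add_right k j)).trans (hit (k + j) x)) ih
      rwa [sub_add_sub_cancel] at this
  -- The iterates are only known to be `ϖ`-adically Cauchy. Every `e`-th iterate gives a
  -- `p`-adically Cauchy sequence, as `p ∣ ϖ ^ e`.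
  have hlim := fun x => PComp.exists_limit (fun m => F^[e * m] 0 x) fun m => by
    refine (pow_dvd_pow_of_dvd h2 m).trans ?_
    rw [← pow_mul, mul_add]
    exact hitadd _ _ _
  choose L hL using hlim
  refine ⟨L, ?_, fun g hg => hun g L hg ?_⟩ <;>
  · ext1 x
    refine sub_eq_zero.mp (hsep _ fun k => ?_)
    have hL' : ∀ x, ϖ ^ k ∣ L x - F^[e * k] 0 x := fun x =>
      (pow_dvd_pow_of_dvd h1 k).trans (hL x k)
    have a1 := (pow_dvd_pow ϖ k.le_succ).trans (hF k _ _ hL' x)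
    -- For `e = 0` the bound `k ≤ e * k` used below fails, but then `p`, and with it `ϖ`, is a unit.
    rcases Nat.eq_zero_or_pos e with rfl | he
    · have : IsUnit (p : PComp p S) := by simpa [isUnit_iff_dvd_one] using h2
      exact ((isUnit_of_dvd_unit h1 this).pow k).dvd
    have a2 := (pow_dvd_pow ϖ (Nat.le_mul_of_pos_left k he)).trans (hit (e * k) x)
    rw [Function.iterate_succ_apply'] at a2
    have := dvd_sub (dvd_add a1 a2) (hL' x)
    convert this using 1; ring

end PCompFacts

/-! ### Ring maps out of the completed coordinate ring. -/

section GLFacts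

variable {p : ℕ} {S T : Type*} [CommRing S] [CommRing T] {N : ℕ}

theorem CoordRing.hom_ext {D : Type*} [CommRing D] {f g : CoordRing S N →+* D}
    (h : ∀ a, f (algebraMap S (CoordRing S N) a) = g (algebraMap S (CoordRing S N) a))
    (hx : ∀ a b, f (coordMatrix N a b) = g (coordMatrix N a b)) : f = g := by
  refine IsLocalization.ringHom_ext
    (Submonoid.powers (Matrix.mvPolynomialX (Fin N) (Fin N) S).det) ?_
  refine MvPolynomial.ringHom_ext (fun a => ?_) fun ab => ?_
  · have := h a
    rwa [IsScalarTower.algebraMap_apply S (MvPolynomial (Fin N × Fin N) S) (CoordRing S N)] at this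
  · have := hx ab.1 ab.2
    simpa [coordMatrix, Matrix.mvPolynomialX] using this

theorem coordEval_coordMatrix {D : Type*} [CommRing D] (f : S →+* D) (M : GL (Fin N) D)
    (a b : Fin N) : coordEval f M (coordMatrix N a b) = M.val a b := by
  rw [coordMatrix, Matrix.map_apply, coordEval, IsLocalization.Away.lift_eq]
  simp [Matrix.mvPolynomialX]

theorem genX_apply (a b : Fin N) :
    (genX p N).val a b = algebraMap (CoordRing S N) (GLComp p S N) (coordMatrix N a b) := rfl

theorem glEval_algebraMap (f : S →+* PComp p T) (M : GL (Fin N) (PComp p T)) (a : S) :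
    glEval f M (algebraMap S (GLComp p S N) a) = f a := by
  rw [IsScalarTower.algebraMap_apply S (CoordRing S N) (GLComp p S N), glEval,
    PComp.lift_algebraMap, coordEval_algebraMap]

theorem map_glEval_genX (f : S →+* PComp p T) (M : GL (Fin N) (PComp p T)) :
    (genX p N).val.map (glEval f M) = M.val := by
  ext a b
  rw [Matrix.map_apply, genX_apply, glEval, PComp.lift_algebraMap, coordEval_coordMatrix]

theorem glHom_ext {f g : GLComp p S N →+* PComp p T}
    (h : f.comp (algebraMap S (GLComp p S N)) = g.comp (algebraMap S (GLComp p S N)))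
    (hx : (genX p N).val.map f = (genX p N).val.map g) : f = g := by
  refine PComp.hom_ext (CoordRing.hom_ext (fun a => ?_) fun a b => ?_)
  · have := congrArg (fun e : S →+* PComp p T => e a) h
    simpa [IsScalarTower.algebraMap_apply S (CoordRing S N) (GLComp p S N)] using this
  · exact congrFun (congrFun hx a) b

theorem glHom_eq_iff {f g : GLComp p S N →+* PComp p T}
    (h : f.comp (algebraMap S (GLComp p S N)) = g.comp (algebraMap S (GLComp p S N))) :
    f = g ↔ (genX p N).val.map f = (genX p N).val.map g :=
  ⟨fun e => by rw [e], glHom_ext h⟩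

theorem glHom_ext_of_pow_eq_zero {B : Type*} [CommRing B] {m : ℕ} (hm : (p : B) ^ m = 0)
    {f g : GLComp p S N →+* B}
    (h : ∀ a, f (algebraMap S (GLComp p S N) a) = g (algebraMap S (GLComp p S N) a))
    (hx : ∀ a b, f ((genX p N).val a b) = g ((genX p N).val a b)) : f = g := by
  have hc : f.comp (algebraMap (CoordRing S N) (GLComp p S N)) =
      g.comp (algebraMap (CoordRing S N) (GLComp p S N)) := by
    refine CoordRing.hom_ext (fun a => ?_) fun a b => hx a b
    simpa [IsScalarTower.algebraMap_apply S (CoordRing S N) (GLComp p S N)] using h a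
  ext1 y
  rw [← sub_eq_zero]
  refine (Ideal.mem_bot).mp (PComp.hom_congr (m := m) (hm ▸ zero_mem _) (fun a => ?_) y)
  have := congrArg (fun e : CoordRing S N →+* B => e a) hc
  simp only [RingHom.comp_apply] at this
  rw [this, sub_self]
  exact zero_mem _

/-- Modulo `ϖ` the prime `p` vanishes, so the `p ^ s`-power map is a ring map there. The congruence
becomes an equality of two ring maps into a ring killed by `p`, which is tested on constants and on
the entries of `x`. -/
theorem isFrobLift_of_generators [Fact p.Prime] {s : ℕ} {ϖ : GLComp p S N}
    (hϖ : ϖ ∣ (p : GLComp p S N)) {f : GLComp p S N →+* GLComp p S N}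
    (h : ∀ a : S, ϖ ∣ f (algebraMap S _ a) - algebraMap S _ a ^ p ^ s)
    (hx : ∀ a b, ϖ ∣ f ((genX p N).val a b) - (genX p N).val a b ^ p ^ s) :
    IsFrobLift p s ϖ f := by
  intro y
  rw [← Ideal.mem_span_singleton, ← Ideal.Quotient.eq_zero_iff_mem]
  rcases subsingleton_or_nontrivial (GLComp p S N ⧸ Ideal.span {ϖ}) with hQ | hQ
  · exact Subsingleton.elim _ _
  have h0 : ((p : ℕ) : GLComp p S N ⧸ Ideal.span {ϖ}) = 0 := by
    rw [← map_natCast (Ideal.Quotient.mk (Ideal.span {ϖ})),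
      Ideal.Quotient.eq_zero_iff_mem, Ideal.mem_span_singleton]
    exact hϖ
  have : CharP (GLComp p S N ⧸ Ideal.span {ϖ}) p :=
    (CharP.charP_iff_prime_eq_zero Fact.out).mpr h0
  have key : (Ideal.Quotient.mk (Ideal.span {ϖ})).comp f =
      (iterateFrobenius _ p s).comp (Ideal.Quotient.mk (Ideal.span {ϖ})) := by
    refine glHom_ext_of_pow_eq_zero (p := p) (m := 1) (by rw [pow_one, h0]) (fun a => ?_)
      fun a b => ?_ <;>
    rw [RingHom.comp_apply, RingHom.comp_apply, iterateFrobenius_def, ← map_pow,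
      ← sub_eq_zero, ← map_sub, Ideal.Quotient.eq_zero_iff_mem, Ideal.mem_span_singleton]
    · exact h a
    · exact hx a b
  have := congrArg (fun e : GLComp p S N →+* _ => e y) key
  simp only [RingHom.comp_apply, iterateFrobenius_def] at this
  rw [map_sub, map_pow, this, sub_self]

/-- The element `a` divides `b ^ e - (b - a) ^ e`, which is congruent to the unit `b ^ e` modulo
`p`. -/
theorem PComp.isUnit_of_dvd_sub {ϖ a b : PComp p S} {e : ℕ} (h2 : (p : PComp p S) ∣ ϖ ^ e)
    (hb : IsUnit b) (h : ϖ ∣ a - b) : IsUnit a := by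
  have h1 : (p : PComp p S) ∣ (b - a) ^ e :=
    h2.trans (pow_dvd_pow_of_dvd ((dvd_sub_comm).mp h) e)
  have h3 : IsUnit (b ^ e - (b - a) ^ e) := by
    refine PComp.isUnit_of_sub_dvd (hb.pow e) ?_
    simpa using h1
  have h4 : a ∣ b ^ e - (b - a) ^ e := by simpa using sub_dvd_pow_sub_pow b (b - a) e
  exact isUnit_of_dvd_unit h4 h3

/-- Entrywise divisibility by `ϖ`. -/
def MatDvd {D : Type*} [CommRing D] (ϖ : D) (M : Matrix (Fin N) (Fin N) D) : Prop :=
  ∀ a b, ϖ ∣ M a b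

section MatDvd

variable {D : Type*} [CommRing D] {ϖ : D} {M M' : Matrix (Fin N) (Fin N) D}

theorem matDvd_iff_smul : MatDvd ϖ M ↔ ∃ M', M = ϖ • M' := by
  constructor
  · intro h
    choose f hf using h
    exact ⟨Matrix.of f, by ext a b; simp [hf]⟩
  · rintro ⟨M', rfl⟩ a b
    simp

theorem MatDvd.add (h : MatDvd ϖ M) (h' : MatDvd ϖ M') : MatDvd ϖ (M + M') :=
  fun a b => dvd_add (h a b) (h' a b)

theorem MatDvd.sub (h : MatDvd ϖ M) (h' : MatDvd ϖ M') : MatDvd ϖ (M - M') :=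
  fun a b => dvd_sub (h a b) (h' a b)

theorem MatDvd.mul_right (h : MatDvd ϖ M) (M') : MatDvd ϖ (M * M') :=
  fun a b => by
    rw [Matrix.mul_apply]
    exact Finset.dvd_sum fun _ _ => (h _ _).mul_right _

theorem MatDvd.mul_left (h : MatDvd ϖ M) (M') : MatDvd ϖ (M' * M) :=
  fun a b => by
    rw [Matrix.mul_apply]
    exact Finset.dvd_sum fun _ _ => (h _ _).mul_left _

theorem MatDvd.transpose (h : MatDvd ϖ M) : MatDvd ϖ Mᵀ := fun a b => h b a

theorem MatDvd.smul (h : MatDvd ϖ M) {η : D} (c : D) (hc : η ∣ c) : MatDvd (η * ϖ) (c • M) :=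
  fun a b => mul_dvd_mul hc (h a b)

theorem MatDvd.map {E : Type*} [CommRing E] (h : MatDvd ϖ M) (f : D →+* E) :
    MatDvd (f ϖ) (M.map f) := fun a b => map_dvd f (h a b)

theorem MatDvd.det_sub_one (h : MatDvd ϖ (M - 1)) : ϖ ∣ M.det - 1 := by
  rw [← Ideal.mem_span_singleton, ← Ideal.Quotient.eq_zero_iff_mem, map_sub, RingHom.map_det,
    map_one, sub_eq_zero]
  have : (Ideal.Quotient.mk (Ideal.span {ϖ})).mapMatrix M = 1 := by
    rw [← sub_eq_zero, ← map_one (Ideal.Quotient.mk (Ideal.span {ϖ})).mapMatrix, ← map_sub]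
    ext a b
    rw [RingHom.mapMatrix_apply, Matrix.map_apply, Matrix.zero_apply,
      Ideal.Quotient.eq_zero_iff_mem, Ideal.mem_span_singleton]
    exact h a b
  rw [this, Matrix.det_one]

end MatDvd

end GLFacts

/-! ### Connections expressed by the matrices `Λ`. -/

section ConnectionFacts

variable {p s : ℕ} [Fact p.Prime] {S : Type*} [CommRing S] {ϖ : S} {n : ℕ}
  {φ : Fin n → S →+* S} {N : ℕ}

theorem genXPow_val : (genXPow p N s).val = entryPow (genX (S := S) p N).val (p ^ s) := rfl

namespace PiConnection

theorem lift_algebraMap (D : PiConnection p s ϖ φ N) (i : Fin n) (a : S) :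
    D.lift i (algebraMap S _ a) = algebraMap S _ (φ i a) :=
  congrArg (fun e : S →+* GLComp p S N => e a) (D.extends_base i)

theorem map_lift_genX (D : PiConnection p s ϖ φ N) (i : Fin n) :
    (genX p N).val.map (D.lift i) = (genXPow p N s).val * D.Lam i := by
  rw [Lam, ← mul_assoc, ← Units.val_mul, mul_inv_cancel, Units.val_one, one_mul]

/-- This replaces the Christoffel symbols, which are built from a chosen quotient by `ϖ`, by the
canonical matrix `Λ_i`. All equations are stated for the latter. -/
theorem Lam_eq (D : PiConnection p s ϖ φ N) (i : Fin n) :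
    D.Lam i = 1 + algebraMap S (GLComp p S N) ϖ • (D.Gam i)ᵀ := by
  have : (genX p N).val.map (D.lift i) = (genXPow p N s).val +
      algebraMap S (GLComp p S N) ϖ • (genX p N).val.map (D.deriv i) := by
    refine Matrix.ext fun a b => ?_
    have := (D.isFrobLift i ((genX p N).val a b)).choose_spec
    simp only [Matrix.map_apply, Matrix.add_apply, Matrix.smul_apply, smul_eq_mul, genXPow_val,
      entryPow, deriv]
    exact (sub_eq_iff_eq_add'.mp this)
  rw [Lam, this, mul_add, ← Units.val_mul, inv_mul_cancel, Units.val_one, Gam,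
    Matrix.transpose_transpose, Matrix.mul_smul]

theorem matDvd_Lam_sub_one (D : PiConnection p s ϖ φ N) (i : Fin n) :
    MatDvd (algebraMap S (GLComp p S N) ϖ) (D.Lam i - 1) := by
  rw [Lam_eq, add_sub_cancel_left]
  exact matDvd_iff_smul.mpr ⟨_, rfl⟩

theorem ext_Lam {D D' : PiConnection p s ϖ φ N} (h : D.Lam = D'.Lam) : D = D' := by
  refine PiConnection.ext (funext fun i => glHom_ext ?_ ?_)
  · rw [D.extends_base, D'.extends_base]
  · rw [map_lift_genX, map_lift_genX, h]

/-- With `ext_Lam` and `matDvd_Lam_sub_one` this makes `Λ` a coordinate system: connections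
correspond bijectively to tuples of matrices congruent to 1. -/
theorem exists_Lam_eq (hϖ : ϖ ∣ (p : S)) {e : ℕ} (he : (p : S) ∣ ϖ ^ e)
    (hφ : ∀ i, IsFrobLift p s ϖ (φ i)) {Λ : Fin n → Matrix (Fin N) (Fin N) (GLComp p S N)}
    (hΛ : ∀ i, MatDvd (algebraMap S (GLComp p S N) ϖ) (Λ i - 1)) :
    ∃ D : PiConnection p s ϖ φ N, D.Lam = Λ := by
  have hu : ∀ i, IsUnit (Λ i).det := fun i =>
    PComp.isUnit_of_dvd_sub (e := e)
      (by simpa using map_dvd (algebraMap S (GLComp p S N)) he) isUnit_one (hΛ i).det_sub_one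
  let f : Fin n → GLComp p S N →+* GLComp p S N := fun i =>
    glEval ((algebraMap S (GLComp p S N)).comp (φ i))
      (genXPow p N s * Matrix.GeneralLinearGroup.mk'' (Λ i) (hu i))
  have hf : ∀ i, (genX p N).val.map (f i) = (genXPow p N s).val * Λ i := fun i =>
    map_glEval_genX _ _
  have hfr : ∀ i, IsFrobLift p s (algebraMap S (GLComp p S N) ϖ) (f i) := by
    intro i
    refine isFrobLift_of_generators (by simpa using map_dvd (algebraMap S (GLComp p S N)) hϖ)
      (fun a => ?_) fun a b => ?_
    · rw [glEval_algebraMap, RingHom.comp_apply, ← map_pow, ← map_sub]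
      exact map_dvd _ (hφ i a)
    · have h1 : MatDvd (algebraMap S (GLComp p S N) ϖ)
          ((genX p N).val.map (f i) - (genXPow p N s).val) := by
        rw [hf, ← mul_one (genXPow p N s).val, mul_assoc, one_mul, ← mul_sub]
        exact (hΛ i).mul_left _
      exact h1 a b
  refine ⟨⟨f, hfr, fun i => ?_⟩, funext fun i => ?_⟩
  · ext1 a
    exact glEval_algebraMap _ _ a
  · change (genXPow p N s)⁻¹.val * (genX p N).val.map (f i) = Λ i
    rw [hf, ← mul_assoc, ← Units.val_mul, inv_mul_cancel, Units.val_one, one_mul]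

end PiConnection

variable (p s) in
/-- The matrix `(x^(p ^ s))ᵗ φ(q) x^(p ^ s)`. -/
noncomputable def twistedMetric (φ : S →+* S) (q : GL (Fin N) S) : Matrix (Fin N) (Fin N) (GLComp p S N) :=
  (genXPow p N s).valᵀ * q.val.map ((algebraMap S (GLComp p S N)).comp φ) * (genXPow p N s).val

variable (p s) in
/-- The matrix `(xᵗ q x)^(p ^ s)`. -/
noncomputable def metricPow (q : GL (Fin N) S) : Matrix (Fin N) (Fin N) (GLComp p S N) :=
  entryPow ((genX p N).valᵀ * q.val.map (algebraMap S (GLComp p S N)) * (genX p N).val) (p ^ s)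

theorem map_metricMap_genX (q : GL (Fin N) S) : (genX p N).val.map (metricMap p q) =
    (genX p N).valᵀ * q.val.map (algebraMap S (GLComp p S N)) * (genX p N).val :=
  map_glEval_genX _ _

theorem entryPow_map {D E : Type*} [CommRing D] [CommRing E] (f : D →+* E)
    (X : Matrix (Fin N) (Fin N) D) (m : ℕ) : (entryPow X m).map f = entryPow (X.map f) m := by
  ext a b
  simp [entryPow]

/-- Both composites restrict to `φ i` on `S`, so only their values at `x` matter. -/
theorem PiConnection.isMetric_iff (D : PiConnection p s ϖ φ N) (q : GL (Fin N) S) :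
    D.IsMetric q ↔
      ∀ i, (D.Lam i)ᵀ * twistedMetric p s (φ i) q * D.Lam i = metricPow p s q := by
  refine forall_congr' fun i => ?_
  rw [glHom_eq_iff]
  · have h1 : (genX p N).val.map ((D.lift i).comp (metricMap p q)) =
        (D.Lam i)ᵀ * twistedMetric p s (φ i) q * D.Lam i := by
      rw [RingHom.coe_comp, ← Matrix.map_map, map_metricMap_genX, Matrix.map_mul, Matrix.map_mul,
        Matrix.transpose_map, D.map_lift_genX, Matrix.map_map, ← RingHom.coe_comp,
        D.extends_base, twistedMetric, Matrix.transpose_mul]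
      simp only [mul_assoc]
    have h2 : (genX p N).val.map ((metricMap p q).comp (trivialLift p s (φ i) N)) =
        metricPow p s q := by
      rw [RingHom.coe_comp, ← Matrix.map_map, trivialLift, map_glEval_genX, genXPow_val,
        entryPow_map, map_metricMap_genX, metricPow]
    rw [h1, h2]
  · ext1 a
    have := congrArg (fun e : S →+* GLComp p S N => e a) (trivialLift_comp p s (φ i) N)
    simp only [RingHom.comp_apply] at this ⊢
    rw [this, metricMap, glEval_algebraMap, glEval_algebraMap, D.lift_algebraMap]

theorem tensorLift_includeLeft {S B C D : Type*} [CommRing S] [CommRing B] [CommRing C]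
    [CommRing D] [Algebra S B] [Algebra S C] (f : B →+* D) (g : C →+* D)
    (h : f.comp (algebraMap S B) = g.comp (algebraMap S C)) (b : B) :
    tensorLift f g h (b ⊗ₜ 1) = f b := by
  let _ : Algebra S D := (f.comp (algebraMap S B)).toAlgebra
  simp [tensorLift]

theorem tensorLift_includeRight {S B C D : Type*} [CommRing S] [CommRing B] [CommRing C]
    [CommRing D] [Algebra S B] [Algebra S C] (f : B →+* D) (g : C →+* D)
    (h : f.comp (algebraMap S B) = g.comp (algebraMap S C)) (c : C) :
    tensorLift f g h (1 ⊗ₜ c) = g c := by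
  let _ : Algebra S D := (f.comp (algebraMap S B)).toAlgebra
  simp [tensorLift]

theorem tensorMap_algebraMap {f g : GLComp p S N →+* GLComp p S N}
    (h : f.comp (algebraMap S (GLComp p S N)) = g.comp (algebraMap S (GLComp p S N))) (a : S) :
    tensorMap f g h (algebraMap S (GLComp₂ p S N) a) = f (algebraMap S _ a) := by
  rw [IsScalarTower.algebraMap_apply S (GLComp p S N ⊗[S] GLComp p S N) (GLComp₂ p S N),
    tensorMap, PComp.lift_algebraMap, Algebra.TensorProduct.algebraMap_apply,
    tensorLift_includeLeft]

theorem tensorMap_includeLeft {f g : GLComp p S N →+* GLComp p S N}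
    (h : f.comp (algebraMap S (GLComp p S N)) = g.comp (algebraMap S (GLComp p S N)))
    (a : GLComp p S N) :
    tensorMap f g h (algebraMap _ (GLComp₂ p S N) (a ⊗ₜ[S] (1 : GLComp p S N))) = f a := by
  rw [tensorMap, PComp.lift_algebraMap, tensorLift_includeLeft]

theorem tensorMap_includeRight {f g : GLComp p S N →+* GLComp p S N}
    (h : f.comp (algebraMap S (GLComp p S N)) = g.comp (algebraMap S (GLComp p S N)))
    (a : GLComp p S N) :
    tensorMap f g h (algebraMap _ (GLComp₂ p S N) ((1 : GLComp p S N) ⊗ₜ[S] a)) = g a := by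
  rw [tensorMap, PComp.lift_algebraMap, tensorLift_includeRight]

theorem map_tensorMap_bilinMap {f g : GLComp p S N →+* GLComp p S N}
    (h : f.comp (algebraMap S (GLComp p S N)) = g.comp (algebraMap S (GLComp p S N)))
    (q : GL (Fin N) S) :
    (genX p N).val.map ((tensorMap f g h).comp (bilinMap p q)) =
      ((genX p N).val.map f)ᵀ * q.val.map (f.comp (algebraMap S (GLComp p S N))) *
        (genX p N).val.map g := by
  rw [RingHom.coe_comp, ← Matrix.map_map, bilinMap, map_glEval_genX, Units.val_mul,
    Units.val_mul, Matrix.map_mul, Matrix.map_mul]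
  refine congrArg₂ _ (congrArg₂ _ (Matrix.ext fun a b => ?_) (Matrix.ext fun a b => ?_))
    (Matrix.ext fun a b => ?_)
  · exact tensorMap_includeLeft h ((genX p N).val b a)
  · rw [Matrix.map_apply, Matrix.map_apply, RingHom.comp_apply, ← tensorMap_algebraMap h,
      Matrix.GeneralLinearGroup.map_apply]
  · exact tensorMap_includeRight h ((genX p N).val a b)

theorem PiConnection.isBilinSymmetric_iff (D : PiConnection p s ϖ φ N) (q : GL (Fin N) S) :
    D.IsBilinSymmetric q ↔
      ∀ i, (D.Lam i)ᵀ * twistedMetric p s (φ i) q = twistedMetric p s (φ i) q * D.Lam i := by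
  refine forall_congr' fun i => ?_
  rw [glHom_eq_iff]
  · have h0 : (genX p N).val.map (trivialLift p s (φ i) N) = (genXPow p N s).val :=
      map_glEval_genX _ _
    rw [map_tensorMap_bilinMap, map_tensorMap_bilinMap, D.map_lift_genX, h0, D.extends_base,
      trivialLift_comp, twistedMetric, Matrix.transpose_mul]
    simp only [mul_assoc]
  · ext1 a
    have := congrArg (fun e : S →+* GLComp p S N => e a) (trivialLift_comp p s (φ i) N)
    simp only [RingHom.comp_apply] at this ⊢
    rw [bilinMap, glEval_algebraMap, tensorMap_algebraMap, tensorMap_algebraMap, this,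
      D.lift_algebraMap]

end ConnectionFacts

/-! ### Square roots of matrices and the Koszul formula. -/

section Solve

theorem PComp.isUnit_two {p : ℕ} (hp : Odd p) {S : Type*} [CommRing S] :
    IsUnit (2 : PComp p S) := by
  obtain ⟨k, hk⟩ := hp
  refine isUnit_of_mul_isUnit_left (y := -(k : PComp p S)) ?_
  refine PComp.isUnit_of_sub_dvd isUnit_one ⟨-1, ?_⟩
  rw [hk]; push_cast; ring

variable {p : ℕ} {S : Type*} [CommRing S] {ϖ : PComp p S} {e N : ℕ}

theorem existsUnique_fixedPoint_matrix (h1 : ϖ ∣ (p : PComp p S)) (h2 : (p : PComp p S) ∣ ϖ ^ e)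
    {I : Type*} (F : (I → Matrix (Fin N) (Fin N) (PComp p S)) → I → Matrix (Fin N) (Fin N) (PComp p S))
    (hF : ∀ k f g, (∀ i, MatDvd (ϖ ^ k) (f i - g i)) → ∀ i, MatDvd (ϖ ^ (k + 1)) (F f i - F g i)) :
    ∃! f, F f = f := by
  let c : (I × Fin N × Fin N → PComp p S) → I → Matrix (Fin N) (Fin N) (PComp p S) :=
    fun f i => Matrix.of fun a b => f (i, a, b)
  let d : (I → Matrix (Fin N) (Fin N) (PComp p S)) → I × Fin N × Fin N → PComp p S :=
    fun M x => M x.1 x.2.1 x.2.2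
  have hcd : ∀ M, c (d M) = M := fun M => rfl
  have hdc : ∀ f, d (c f) = f := fun f => rfl
  obtain ⟨f, hf, hu⟩ := PComp.existsUnique_fixedPoint h1 h2 (fun f => d (F (c f)))
    fun k f g hfg x => hF k (c f) (c g) (fun i a b => hfg (i, a, b)) x.1 x.2.1 x.2.2
  refine ⟨c f, ?_, fun M hM => ?_⟩
  · change F (c f) = c f
    rw [← hcd (F (c f))]
    exact congrArg c hf
  · rw [← hcd M]
    refine congrArg c (hu (d M) ?_)
    change d (F (c (d M))) = d M
    rw [hcd, hM]

section Cancel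

variable {D : Type*} [CommRing D] {η : D} (hη : ∀ y, η * y = 0 → y = 0)

include hη in
theorem smul_matrix_cancel {M M' : Matrix (Fin N) (Fin N) D} (h : η • M = η • M') : M = M' := by
  refine Matrix.ext fun a b => ?_
  rw [← sub_eq_zero]
  refine hη _ ?_
  have := congrFun (congrFun h a) b
  simp only [Matrix.smul_apply, smul_eq_mul] at this
  rw [mul_sub, this, sub_self]

end Cancel

theorem MatDvd.mul_sub_mul {D : Type*} [CommRing D] {η : D} {M M' P P' : Matrix (Fin N) (Fin N) D}
    (h : MatDvd η (M - M')) (h' : MatDvd η (P - P')) : MatDvd η (M * P - M' * P') := by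
  have : M * P - M' * P' = (M - M') * P + M' * (P - P') := by noncomm_ring
  rw [this]
  exact (h.mul_right _).add (h'.mul_left _)

/-- Uniqueness and existence of the square root congruent to `1` of a matrix congruent to `1`. -/
theorem existsUnique_sqrt (h1 : ϖ ∣ (p : PComp p S)) (h2 : (p : PComp p S) ∣ ϖ ^ e)
    (hreg : ∀ y, ϖ * y = 0 → y = 0) (htwo : IsUnit (2 : PComp p S)) {I : Type*}
    {E : I → Matrix (Fin N) (Fin N) (PComp p S)} (hE : ∀ i, MatDvd ϖ (E i - 1)) :
    ∃! Λ : I → Matrix (Fin N) (Fin N) (PComp p S),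
      ∀ i, MatDvd ϖ (Λ i - 1) ∧ Λ i * Λ i = E i := by
  obtain ⟨h, hh⟩ := htwo.exists_left_inv
  choose C hC using fun i => matDvd_iff_smul.mp (hE i)
  -- From `(1 + ϖM)² = 1 + ϖ(2M + ϖM²)`, cancelling `ϖ` and halving give `M = (C - ϖM²)/2`. The
  -- right-hand side is contracting because of the factor `ϖ`.
  have hiff : ∀ M i, (1 + ϖ • M) * (1 + ϖ • M) = E i ↔ h • (C i - ϖ • (M * M)) = M := by
    intro M i
    have e1 : (1 + ϖ • M) * (1 + ϖ • M) = 1 + ϖ • ((2 : PComp p S) • M + ϖ • (M * M)) := by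
      simp only [mul_add, add_mul, mul_one, one_mul, Matrix.smul_mul, Matrix.mul_smul]
      module
    rw [e1, ← sub_add_cancel (E i) 1, hC, add_comm, add_left_inj]
    constructor
    · intro H
      rw [← smul_matrix_cancel hreg H, add_sub_cancel_right, smul_smul, hh, one_smul]
    · intro H
      have : (2 : PComp p S) • M = C i - ϖ • (M * M) := by
        conv_lhs => rw [← H]
        rw [smul_smul, mul_comm, hh, one_smul]
      rw [this, sub_add_cancel]
  obtain ⟨M, hM, hu⟩ := existsUnique_fixedPoint_matrix h1 h2
    (fun (M : I → Matrix (Fin N) (Fin N) (PComp p S)) i => h • (C i - ϖ • (M i * M i)))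
    fun k f g hfg i => by
      have : h • (C i - ϖ • (f i * f i)) - h • (C i - ϖ • (g i * g i)) =
          (-h * ϖ) • (f i * f i - g i * g i) := by module
      rw [this, pow_succ']
      exact ((hfg i).mul_sub_mul (hfg i)).smul _ (Dvd.intro_left _ rfl)
  refine ⟨fun i => 1 + ϖ • M i, fun i => ⟨?_, (hiff _ _).mpr (congrFun hM i)⟩, fun Λ hΛ => ?_⟩
  · rw [add_sub_cancel_left]
    exact matDvd_iff_smul.mpr ⟨_, rfl⟩
  · choose M' hM' using fun i => matDvd_iff_smul.mp (hΛ i).1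
    have hΛ' : ∀ i, Λ i = 1 + ϖ • M' i := fun i => by rw [← hM', add_sub_cancel]
    have : M' = M := hu M' (funext fun i => (hiff _ _).mp (by rw [← hΛ']; exact (hΛ i).2))
    rw [← this]
    exact funext hΛ'

/-- The matrices `Λ_i` that determine the Chern connection. -/
theorem existsUnique_chern (h1 : ϖ ∣ (p : PComp p S)) (h2 : (p : PComp p S) ∣ ϖ ^ e)
    (hreg : ∀ y, ϖ * y = 0 → y = 0) (htwo : IsUnit (2 : PComp p S)) {I : Type*}
    {A : I → Matrix (Fin N) (Fin N) (PComp p S)} {B : Matrix (Fin N) (Fin N) (PComp p S)}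
    (hA : ∀ i, (A i)ᵀ = A i) (hAu : ∀ i, IsUnit (A i).det) (hB : Bᵀ = B)
    (hAB : ∀ i, MatDvd ϖ (B - A i)) :
    ∃! Λ : I → Matrix (Fin N) (Fin N) (PComp p S),
      (∀ i, MatDvd ϖ (Λ i - 1)) ∧ (∀ i, (Λ i)ᵀ * A i = A i * Λ i) ∧
        ∀ i, (Λ i)ᵀ * A i * Λ i = B := by
  have hE : ∀ i, MatDvd ϖ ((A i)⁻¹ * B - 1) := fun i => by
    rw [← Matrix.nonsing_inv_mul _ (hAu i), ← mul_sub]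
    exact (hAB i).mul_left _
  obtain ⟨Λ, hΛ, hu⟩ := existsUnique_sqrt h1 h2 hreg htwo hE
  -- The transpose of `Λ` conjugated by `A` is again a square root of `A⁻¹ B` congruent to 1, by the
  -- symmetry of `A` and `B`. Uniqueness identifies it with `Λ`.
  have hsymm : ∀ i, (Λ i)ᵀ * A i = A i * Λ i := by
    have := hu (fun i => (A i)⁻¹ * (Λ i)ᵀ * A i) fun i => ⟨?_, ?_⟩
    · intro i
      have h5 := congrArg (A i * ·) (congrFun this i)
      simp only [mul_assoc] at h5
      rwa [Matrix.mul_nonsing_inv_cancel_left _ _ (hAu i)] at h5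
    · have : (A i)⁻¹ * (Λ i)ᵀ * A i - 1 = (A i)⁻¹ * (Λ i - 1)ᵀ * A i := by
        rw [Matrix.transpose_sub, Matrix.transpose_one, mul_sub, sub_mul, mul_one,
          Matrix.nonsing_inv_mul _ (hAu i)]
      rw [this]
      exact ((hΛ i).1.transpose.mul_left _).mul_right _
    · have h3 : (Λ i)ᵀ * (Λ i)ᵀ = B * (A i)⁻¹ := by
        rw [← Matrix.transpose_mul, (hΛ i).2, Matrix.transpose_mul, Matrix.transpose_nonsing_inv,
          hA, hB]
      calc (A i)⁻¹ * (Λ i)ᵀ * A i * ((A i)⁻¹ * (Λ i)ᵀ * A i)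
          = (A i)⁻¹ * (Λ i)ᵀ * (A i * (A i)⁻¹) * (Λ i)ᵀ * A i := by simp only [mul_assoc]
        _ = (A i)⁻¹ * ((Λ i)ᵀ * (Λ i)ᵀ) * A i := by
          rw [Matrix.mul_nonsing_inv _ (hAu i)]; simp only [mul_one, mul_assoc]
        _ = (A i)⁻¹ * B := by
          rw [h3, mul_assoc, mul_assoc, Matrix.nonsing_inv_mul _ (hAu i), mul_one]
  refine ⟨Λ, ⟨fun i => (hΛ i).1, hsymm, fun i => ?_⟩, fun Λ' hΛ' => hu Λ' fun i => ⟨hΛ'.1 i, ?_⟩⟩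
  · rw [hsymm, mul_assoc, (hΛ i).2, Matrix.mul_nonsing_inv_cancel_left _ _ (hAu i)]
  · rw [← hΛ'.2.2 i, hΛ'.2.1 i, mul_assoc, Matrix.nonsing_inv_mul_cancel_left _ _ (hAu i)]

/-- The matrices `(P_i)_{lj}` given by the Koszul formula. -/
def koszul {D : Type*} [CommRing D] (h : D) (Q : Fin N → Matrix (Fin N) (Fin N) D)
    (T : Fin N → Fin N → Fin N → D) (i : Fin N) : Matrix (Fin N) (Fin N) D :=
  Matrix.of fun l j => h * (Q i j l + Q j i l - Q l i j + T i j l - T i l j - T j l i)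

/-- The linear algebra behind the classical Levi-Civita connection: permuting the three indices in
the symmetric and the antisymmetric condition and adding with signs leaves `2 P`. Here `h` is the
inverse of 2. -/
theorem eq_koszul_iff {D : Type*} [CommRing D] {h : D} (hh : h * 2 = 1)
    {Q : Fin N → Matrix (Fin N) (Fin N) D} {T : Fin N → Fin N → Fin N → D}
    (hQ : ∀ i, (Q i)ᵀ = Q i) (hT : ∀ i j l, T i j l = -T j i l)
    (P : Fin N → Matrix (Fin N) (Fin N) D) :
    P = koszul h Q T ↔
      (∀ i, (P i)ᵀ + P i = Q i) ∧ ∀ i j l, P i l j - P j l i = T i j l := by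
  have hQ' : ∀ i a b, Q i a b = Q i b a := fun i a b => congrFun (congrFun (hQ i) b) a
  constructor
  · rintro rfl
    refine ⟨fun i => Matrix.ext fun a b => ?_, fun i j l => ?_⟩
    · simp only [koszul, Matrix.add_apply, Matrix.transpose_apply, Matrix.of_apply]
      linear_combination (Q i a b) * hh + h * (hQ' i b a) - h * hT a b i
    · simp only [koszul, Matrix.of_apply]
      linear_combination (T i j l) * hh + (-h) * hT i j l + h * hQ' l j i
  · rintro ⟨h1, h2⟩
    refine funext fun i => Matrix.ext fun l j => ?_
    have h1' : ∀ i a b, P i b a + P i a b = Q i a b := fun i a b => congrFun (congrFun (h1 i) a) b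
    simp only [koszul, Matrix.of_apply, ← h1', ← h2]
    linear_combination (-P i l j) * hh

end Solve

/-! ### Solving the metric and torsion equations together. -/

section LeviCivitaSolve

variable {p : ℕ} {S : Type*} [CommRing S] {ϖ : PComp p S} {e N : ℕ}

/-- The right-hand side of the metric equation, rewritten for the deviation `M` of `Λ` from `1`. -/
def metricRHS {D : Type*} [CommRing D] (η : D) (A C M : Matrix (Fin N) (Fin N) D) :
    Matrix (Fin N) (Fin N) D :=
  C + η • (Mᵀ * C + C * M - Mᵀ * A * M)

/-- Expansion gives `Mᵀ A + A M + η Mᵀ A M = C`. In the linear terms `A` is then replaced by `B - η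
C`: the Koszul formula mixes different indices `i`, so the same matrix `B`, independent of `i`, must
multiply every `M_i`. -/
theorem metric_iff {D : Type*} [CommRing D] {η : D} (hreg : ∀ y, η * y = 0 → y = 0)
    {A B C M : Matrix (Fin N) (Fin N) D} (hC : B - A = η • C) (hB : Bᵀ = B) :
    (1 + η • M)ᵀ * A * (1 + η • M) = B ↔ (B * M)ᵀ + B * M = metricRHS η A C M := by
  have hB' : B = A + η • C := by rw [← hC, add_sub_cancel]
  have e1 : (1 + η • M)ᵀ * A * (1 + η • M) =
      A + η • (Mᵀ * A + A * M + η • (Mᵀ * A * M)) := by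
    simp only [Matrix.transpose_add, Matrix.transpose_one, Matrix.transpose_smul, mul_add, add_mul,
      mul_one, one_mul, Matrix.smul_mul, Matrix.mul_smul]
    module
  have e2 : (B * M)ᵀ + B * M = Mᵀ * A + A * M + η • (Mᵀ * C + C * M) := by
    rw [Matrix.transpose_mul, hB, hB']
    simp only [mul_add, add_mul, Matrix.smul_mul, Matrix.mul_smul]
    module
  rw [e1, e2, metricRHS]
  constructor
  · intro H
    rw [hB', add_right_inj] at H
    rw [← smul_matrix_cancel hreg H]
    module
  · intro H
    have : C = Mᵀ * A + A * M + η • (Mᵀ * A * M) := by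
      rw [← sub_eq_zero] at H ⊢
      rw [← neg_eq_zero, ← H]
      module
    rw [← this, hB']

theorem metricRHS_symm {D : Type*} [CommRing D] {η : D} {A C M : Matrix (Fin N) (Fin N) D}
    (hA : Aᵀ = A) (hC : Cᵀ = C) : (metricRHS η A C M)ᵀ = metricRHS η A C M := by
  simp only [metricRHS, Matrix.transpose_add, Matrix.transpose_sub, Matrix.transpose_smul,
    Matrix.transpose_mul, Matrix.transpose_transpose, hA, hC, mul_assoc]
  rw [add_comm (C * M)]

theorem matDvd_metricRHS_sub {D : Type*} [CommRing D] {η ε : D} {A C M M' : Matrix (Fin N) (Fin N) D}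
    (h : MatDvd ε (M - M')) : MatDvd (η * ε) (metricRHS η A C M - metricRHS η A C M') := by
  have hz : ∀ Z : Matrix (Fin N) (Fin N) D, MatDvd ε (Z - Z) := fun Z a b => by simp
  have ht : MatDvd ε (Mᵀ - M'ᵀ) := by rw [← Matrix.transpose_sub]; exact h.transpose
  have : metricRHS η A C M - metricRHS η A C M' =
      η • ((Mᵀ * C - M'ᵀ * C) + (C * M - C * M') - (Mᵀ * A * M - M'ᵀ * A * M')) := by
    simp only [metricRHS]; module
  rw [this]
  exact (((ht.mul_sub_mul (hz C)).add ((hz C).mul_sub_mul h)).sub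
    ((ht.mul_sub_mul (hz A)).mul_sub_mul h)).smul _ dvd_rfl

/-- The matrices `Λ_i` that determine the Levi-Civita connection. -/
theorem existsUnique_leviCivita (h1 : ϖ ∣ (p : PComp p S)) (h2 : (p : PComp p S) ∣ ϖ ^ e)
    (hreg : ∀ y, ϖ * y = 0 → y = 0) (htwo : IsUnit (2 : PComp p S))
    {A : Fin N → Matrix (Fin N) (Fin N) (PComp p S)} {B : Matrix (Fin N) (Fin N) (PComp p S)}
    (hA : ∀ i, (A i)ᵀ = A i) (hB : Bᵀ = B) (hBu : IsUnit B.det)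
    (hAB : ∀ i, MatDvd ϖ (B - A i))
    {ℓ : (Fin N → Matrix (Fin N) (Fin N) (PComp p S)) → Fin N → Fin N → Fin N → PComp p S}
    (hℓ : ∀ Λ i j k, ℓ Λ i j k = -ℓ Λ j i k)
    (hℓc : ∀ m Λ Λ', (∀ i, MatDvd (ϖ ^ m) (Λ i - Λ' i)) →
      ∀ i j k, ϖ ^ m ∣ ℓ Λ i j k - ℓ Λ' i j k) :
    ∃! Λ : Fin N → Matrix (Fin N) (Fin N) (PComp p S),
      (∀ i, MatDvd ϖ (Λ i - 1)) ∧ (∀ i, (Λ i)ᵀ * A i * Λ i = B) ∧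
        ∀ i j k, (Λ i - 1) k j - (Λ j - 1) k i = ϖ * ℓ Λ i j k := by
  obtain ⟨h, hh⟩ := htwo.exists_left_inv
  choose C hC using fun i => matDvd_iff_smul.mp (hAB i)
  have hCs : ∀ i, (C i)ᵀ = C i := fun i => by
    refine smul_matrix_cancel hreg ?_
    rw [← Matrix.transpose_smul, ← hC, Matrix.transpose_sub, hA, hB]
  let lam : (Fin N → Matrix (Fin N) (Fin N) (PComp p S)) → Fin N → Matrix (Fin N) (Fin N) (PComp p S) :=
    fun M i => 1 + ϖ • M i
  let Q : (Fin N → Matrix (Fin N) (Fin N) (PComp p S)) → Fin N → Matrix (Fin N) (Fin N) (PComp p S) :=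
    fun M i => metricRHS ϖ (A i) (C i) (M i)
  -- The torsion with its upper index lowered by `B`, to match the entries of `B * M i`.
  let T : (Fin N → Matrix (Fin N) (Fin N) (PComp p S)) → Fin N → Fin N → Fin N → PComp p S :=
    fun M i j l => ∑ k, B l k * ℓ (lam M) i j k
  have hQ : ∀ M i, (Q M i)ᵀ = Q M i := fun M i => metricRHS_symm (hA i) (hCs i)
  have hT : ∀ M i j l, T M i j l = -T M j i l := fun M i j l => by
    simp only [T]
    rw [← Finset.sum_neg_distrib]
    exact Finset.sum_congr rfl fun k _ => by rw [hℓ, mul_neg]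
  let F : (Fin N → Matrix (Fin N) (Fin N) (PComp p S)) → Fin N → Matrix (Fin N) (Fin N) (PComp p S) :=
    fun M i => B⁻¹ * koszul h (Q M) (T M) i
  have hF : ∀ k f g, (∀ i, MatDvd (ϖ ^ k) (f i - g i)) →
      ∀ i, MatDvd (ϖ ^ (k + 1)) (F f i - F g i) := by
    intro k f g hfg i
    have hQd : ∀ i, MatDvd (ϖ ^ (k + 1)) (Q f i - Q g i) := fun i => by
      rw [pow_succ']; exact matDvd_metricRHS_sub (hfg i)
    have hTd : ∀ i j l, ϖ ^ (k + 1) ∣ T f i j l - T g i j l := fun i j l => by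
      -- The torsion depends on `M` only through `1 + ϖ M`, which supplies the extra factor `ϖ`.
      simp only [T]
      rw [← Finset.sum_sub_distrib]
      refine Finset.dvd_sum fun m _ => ?_
      rw [← mul_sub]
      refine Dvd.dvd.mul_left (hℓc _ _ _ (fun i => ?_) _ _ _) _
      simp only [lam]
      rw [add_sub_add_left_eq_sub, ← smul_sub, pow_succ']
      exact (hfg i).smul _ dvd_rfl
    simp only [F]
    rw [← mul_sub]
    refine MatDvd.mul_left (fun l j => ?_) _
    have := ((((hQd i j l).add (hQd j i l)).sub (hQd l i j)).add (hTd i j l) |>.sub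
      (hTd i l j) |>.sub (hTd j l i)).mul_left h
    convert this using 1
    simp only [koszul, Matrix.sub_apply, Matrix.of_apply]
    ring
  have hiff : ∀ M, F M = M ↔ (∀ i, (lam M i)ᵀ * A i * lam M i = B) ∧
      ∀ i j k, (lam M i - 1) k j - (lam M j - 1) k i = ϖ * ℓ (lam M) i j k := by
    intro M
    have e1 : F M = M ↔ (fun i => B * M i) = koszul h (Q M) (T M) := by
      constructor
      · intro H
        refine funext fun i => ?_
        conv_lhs => rw [← H]
        exact Matrix.mul_nonsing_inv_cancel_left _ _ hBu
      · intro H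
        refine funext fun i => ?_
        simp only [F]
        rw [← H, Matrix.nonsing_inv_mul_cancel_left _ _ hBu]
    rw [e1, eq_koszul_iff hh (hQ M) (hT M)]
    refine and_congr (forall_congr' fun i => (metric_iff hreg (hC i) hB).symm) ?_
    have e2 : ∀ i j k, (lam M i - 1) k j - (lam M j - 1) k i = ϖ * (M i k j - M j k i) := fun i j k => by
      simp only [lam, add_sub_cancel_left, Matrix.smul_apply, smul_eq_mul, mul_sub]
    -- Lowering the index `k` loses nothing, as `B` is invertible.
    have e3 : ∀ i j, (∀ l, (B * M i) l j - (B * M j) l i = T M i j l) ↔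
        ∀ k, M i k j - M j k i = ℓ (lam M) i j k := by
      intro i j
      have e4 : (B *ᵥ fun k => M i k j - M j k i) = fun l => (B * M i) l j - (B * M j) l i := by
        ext1 l
        simp only [Matrix.mulVec, dotProduct, Matrix.mul_apply, mul_sub, Finset.sum_sub_distrib]
      have e5 : (B *ᵥ fun k => ℓ (lam M) i j k) = fun l => T M i j l := rfl
      have := (Matrix.mulVec_injective_of_isUnit ((Matrix.isUnit_iff_isUnit_det B).mpr hBu)).eq_iff
        (a := fun k => M i k j - M j k i) (b := fun k => ℓ (lam M) i j k)
      rw [e4, e5, funext_iff, funext_iff] at this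
      exact this
    refine forall_congr' fun i => forall_congr' fun j => (e3 i j).trans (forall_congr' fun k => ?_)
    rw [e2]
    refine ⟨fun H => by rw [H], fun H => ?_⟩
    rw [← sub_eq_zero] at H ⊢
    exact hreg _ (by rw [mul_sub, H])
  obtain ⟨M, hM, hu⟩ := existsUnique_fixedPoint_matrix h1 h2 F hF
  refine ⟨lam M, ⟨fun i => ?_, (hiff M).mp hM⟩, fun Λ hΛ => ?_⟩
  · simp only [lam, add_sub_cancel_left]
    exact matDvd_iff_smul.mpr ⟨_, rfl⟩
  · choose M' hM' using fun i => matDvd_iff_smul.mp (hΛ.1 i)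
    obtain rfl : Λ = lam M' := funext fun i => by simp only [lam]; rw [← hM', add_sub_cancel]
    rw [hu M' ((hiff M').mpr hΛ.2)]

end LeviCivitaSolve

/-! ### Regularity of `ϖ`, the congruence `B ≡ A_i`, and existence with uniqueness. -/

section Existence

theorem coordRing_isDomain (S : Type*) [CommRing S] [IsDomain S] (N : ℕ) :
    IsDomain (CoordRing S N) :=
  IsLocalization.isDomain_localization
    (powers_le_nonZeroDivisors_of_noZeroDivisors (Matrix.det_mvPolynomialX_ne_zero (Fin N) S))

theorem algebraMap_coordRing_injective (S : Type*) [CommRing S] [IsDomain S] (N : ℕ) :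
    Function.Injective (algebraMap S (CoordRing S N)) := by
  rw [IsScalarTower.algebraMap_eq S (MvPolynomial (Fin N × Fin N) S) (CoordRing S N)]
  exact (IsLocalization.injective _ (powers_le_nonZeroDivisors_of_noZeroDivisors
    (Matrix.det_mvPolynomialX_ne_zero (Fin N) S))).comp (MvPolynomial.C_injective _ _)

/-- `ϖ` is a regular element of the completed coordinate ring. -/
theorem eq_zero_of_algebraMap_mul {p : ℕ} {S : Type*} [CommRing S] [IsDomain S] (hp : (p : S) ≠ 0)
    {ϖ : S} (hϖ : ϖ ∣ (p : S)) {N : ℕ} (y : GLComp p S N)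
    (hy : algebraMap S (GLComp p S N) ϖ * y = 0) : y = 0 := by
  have := coordRing_isDomain S N
  refine PComp.eq_zero_of_natCast_mul (fun a ha => ?_) ?_
  · refine (mul_eq_zero.mp ha).resolve_left ?_
    rw [← map_natCast (algebraMap S (CoordRing S N))]
    exact (map_ne_zero_iff _ (algebraMap_coordRing_injective S N)).mpr hp
  · obtain ⟨c, hc⟩ := hϖ
    rw [← map_natCast (algebraMap S (GLComp p S N)), hc, mul_comm, map_mul, mul_comm, mul_assoc,
      mul_comm _ y, ← mul_assoc, hy, zero_mul]

variable {p s : ℕ} [Fact p.Prime] {N : ℕ}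

/-- Modulo `η` the characteristic is `p`, and the entrywise power is the iterated Frobenius applied
to a matrix, hence multiplicative. -/
theorem matDvd_entryPow_mul_sub {D : Type*} [CommRing D] {η : D} (hη : η ∣ (p : D))
    (M P : Matrix (Fin N) (Fin N) D) :
    MatDvd η (entryPow (M * P) (p ^ s) - entryPow M (p ^ s) * entryPow P (p ^ s)) := by
  intro a b
  rw [← Ideal.mem_span_singleton, ← Ideal.Quotient.eq_zero_iff_mem]
  rcases subsingleton_or_nontrivial (D ⧸ Ideal.span {η}) with hQ | hQ
  · exact Subsingleton.elim _ _
  have h0 : ((p : ℕ) : D ⧸ Ideal.span {η}) = 0 := by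
    rw [← map_natCast (Ideal.Quotient.mk (Ideal.span {η})),
      Ideal.Quotient.eq_zero_iff_mem, Ideal.mem_span_singleton]
    exact hη
  have : CharP (D ⧸ Ideal.span {η}) p :=
    (CharP.charP_iff_prime_eq_zero Fact.out).mpr h0
  simp only [entryPow, Matrix.sub_apply, Matrix.map_apply, Matrix.mul_apply, map_sub, map_pow,
    map_sum, map_mul]
  rw [← iterateFrobenius_def p s, map_sum, sub_eq_zero]
  exact Finset.sum_congr rfl fun k _ => by rw [map_mul, iterateFrobenius_def, iterateFrobenius_def]

variable {S : Type*} [CommRing S]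

theorem isUnit_det_twistedMetric (φ : S →+* S) (q : GL (Fin N) S) :
    IsUnit (twistedMetric p s φ q).det := by
  rw [twistedMetric, Matrix.det_mul, Matrix.det_mul, Matrix.det_transpose]
  have hX : IsUnit (genXPow (S := S) p N s).val.det :=
    (Matrix.isUnit_iff_isUnit_det _).mp (genXPow p N s).isUnit
  refine (hX.mul ?_).mul hX
  exact (Matrix.isUnit_iff_isUnit_det _).mp
    (Matrix.GeneralLinearGroup.map ((algebraMap S (GLComp p S N)).comp φ) q).isUnit

theorem isUnit_det_metricPow (q : GL (Fin N) S) : IsUnit (metricPow p s q).det := by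
  refine PComp.isUnit_of_sub_dvd (IsUnit.pow (p ^ s) ?_) (dvd_det_entryPow_sub _ s)
  rw [Matrix.det_mul, Matrix.det_mul, Matrix.det_transpose]
  have hX : IsUnit (genX (S := S) p N).val.det :=
    (Matrix.isUnit_iff_isUnit_det _).mp (genX p N).isUnit
  exact (hX.mul ((Matrix.isUnit_iff_isUnit_det _).mp
    (Matrix.GeneralLinearGroup.map (algebraMap S (GLComp p S N)) q).isUnit)).mul hX

theorem transpose_twistedMetric (φ : S →+* S) {q : GL (Fin N) S} (hq : q.val.IsSymm) :
    (twistedMetric p s φ q)ᵀ = twistedMetric p s φ q := by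
  simp only [twistedMetric, Matrix.transpose_mul, Matrix.transpose_transpose, mul_assoc,
    ← Matrix.transpose_map, hq.eq]

theorem transpose_entryPow {D : Type*} [CommRing D] (M : Matrix (Fin N) (Fin N) D) (m : ℕ) :
    (entryPow M m)ᵀ = entryPow Mᵀ m := rfl

theorem transpose_metricPow {q : GL (Fin N) S} (hq : q.val.IsSymm) :
    (metricPow p s q)ᵀ = metricPow p s q := by
  simp only [metricPow, transpose_entryPow, Matrix.transpose_mul, Matrix.transpose_transpose,
    mul_assoc, ← Matrix.transpose_map, hq.eq]

theorem matDvd_metricPow_sub_twistedMetric {ϖ : S} (hϖ : ϖ ∣ (p : S)) {φ : S →+* S}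
    (hφ : IsFrobLift p s ϖ φ) (q : GL (Fin N) S) :
    MatDvd (algebraMap S (GLComp p S N) ϖ) (metricPow p s q - twistedMetric p s φ q) := by
  have hη : algebraMap S (GLComp p S N) ϖ ∣ (p : GLComp p S N) := by
    simpa using map_dvd (algebraMap S (GLComp p S N)) hϖ
  have hz : ∀ Z : Matrix (Fin N) (Fin N) (GLComp p S N),
    MatDvd (algebraMap S (GLComp p S N) ϖ) (Z - Z) := fun Z a b => by simp
  have h1 := matDvd_entryPow_mul_sub (s := s) hη
    ((genX p N).valᵀ * q.val.map (algebraMap S (GLComp p S N))) (genX p N).val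
  have h2 := (matDvd_entryPow_mul_sub (s := s) hη (genX p N).valᵀ
    (q.val.map (algebraMap S (GLComp p S N)))).mul_sub_mul (hz (genXPow p N s).val)
  -- This is where `φ` being a Frobenius lift enters: `φ(q)` is congruent to the entrywise power of
  -- `q`. The differences `h1`, `h2`, `h4` then telescope.
  have h3 : MatDvd (algebraMap S (GLComp p S N) ϖ)
      (entryPow (q.val.map (algebraMap S (GLComp p S N))) (p ^ s) -
        q.val.map ((algebraMap S (GLComp p S N)).comp φ)) := fun a b => by
    have := map_dvd (algebraMap S (GLComp p S N)) (hφ (q.val a b))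
    rw [map_sub, map_pow, dvd_sub_comm] at this
    exact this
  have h4 := ((hz (genXPow p N s).valᵀ).mul_sub_mul h3).mul_sub_mul (hz (genXPow p N s).val)
  have := (h1.add h2).add h4
  rw [genXPow_val, transpose_entryPow, sub_add_sub_cancel, sub_add_sub_cancel] at this
  exact this

variable {ϖ : S} {n : ℕ} {φ : Fin n → S →+* S}

theorem PiConnection.existsUnique_of_Lam (hϖ : ϖ ∣ (p : S)) {e : ℕ} (he : (p : S) ∣ ϖ ^ e)
    (hφ : ∀ i, IsFrobLift p s ϖ (φ i))
    {P : (Fin n → Matrix (Fin N) (Fin N) (GLComp p S N)) → Prop}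
    (h : ∃! Λ, (∀ i, MatDvd (algebraMap S (GLComp p S N) ϖ) (Λ i - 1)) ∧ P Λ) :
    ∃! D : PiConnection p s ϖ φ N, P D.Lam := by
  obtain ⟨Λ, ⟨h1, h2⟩, hu⟩ := h
  obtain ⟨D, rfl⟩ := PiConnection.exists_Lam_eq hϖ he hφ h1
  exact ⟨D, h2, fun D' hD' => PiConnection.ext_Lam (hu _ ⟨D'.matDvd_Lam_sub_one, hD'⟩)⟩

theorem PiConnection.isChern_iff (D : PiConnection p s ϖ φ N) (q : GL (Fin N) S) :
    D.IsChern q ↔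
      (∀ i, (D.Lam i)ᵀ * twistedMetric p s (φ i) q = twistedMetric p s (φ i) q * D.Lam i) ∧
        ∀ i, (D.Lam i)ᵀ * twistedMetric p s (φ i) q * D.Lam i = metricPow p s q :=
  and_congr (D.isBilinSymmetric_iff q) (D.isMetric_iff q)

theorem existsUnique_chern_Lam [IsDomain S] (hp : Odd p) (hp0 : (p : S) ≠ 0) (hϖ : ϖ ∣ (p : S))
    {e : ℕ} (he : (p : S) ∣ ϖ ^ e) (hφ : ∀ i, IsFrobLift p s ϖ (φ i)) {q : GL (Fin N) S}
    (hq : q.val.IsSymm) :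
    ∃! Λ : Fin n → Matrix (Fin N) (Fin N) (GLComp p S N),
      (∀ i, MatDvd (algebraMap S (GLComp p S N) ϖ) (Λ i - 1)) ∧
      (∀ i, (Λ i)ᵀ * twistedMetric p s (φ i) q = twistedMetric p s (φ i) q * Λ i) ∧
        ∀ i, (Λ i)ᵀ * twistedMetric p s (φ i) q * Λ i = metricPow p s q :=
  existsUnique_chern (e := e) (by simpa using map_dvd (algebraMap S (GLComp p S N)) hϖ)
    (by simpa using map_dvd (algebraMap S (GLComp p S N)) he)
    (eq_zero_of_algebraMap_mul hp0 hϖ) (PComp.isUnit_two hp)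
    (fun i => transpose_twistedMetric _ hq) (fun i => isUnit_det_twistedMetric _ q)
    (transpose_metricPow hq) (fun i => matDvd_metricPow_sub_twistedMetric hϖ (hφ i) q)

theorem evalY_algebraMap (Y : Fin n → Matrix (Fin n) (Fin n) (GLComp p S n)) (a : S) :
    evalY Y (algebraMap S (YComp p S n) a) = algebraMap S (GLComp p S n) a := by
  rw [IsScalarTower.algebraMap_apply S (MvPolynomial (Fin n × Fin n × Fin n) S) (YComp p S n),
    evalY, PComp.lift_algebraMap, MvPolynomial.algebraMap_eq, MvPolynomial.coe_eval₂Hom,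
    MvPolynomial.eval₂_C]

/-- For polynomials this is evaluation modulo `η`. It passes to the completion because `η` divides a
power of `p`. -/
theorem dvd_evalY_sub {η : GLComp p S n} {m : ℕ} (hη : η ∣ (p : GLComp p S n) ^ m)
    {Y Y' : Fin n → Matrix (Fin n) (Fin n) (GLComp p S n)} (h : ∀ i, MatDvd η (Y i - Y' i))
    (F : YComp p S n) : η ∣ evalY Y F - evalY Y' F := by
  rw [← Ideal.mem_span_singleton]
  refine PComp.hom_congr (m := m) (Ideal.mem_span_singleton.mpr hη) (fun a => ?_) F
  rw [evalY, evalY, PComp.lift_algebraMap, PComp.lift_algebraMap,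
    ← Ideal.Quotient.eq_zero_iff_mem, map_sub, sub_eq_zero, ← RingHom.comp_apply,
    ← RingHom.comp_apply]
  refine congrArg (fun e : _ →+* _ => e a) (MvPolynomial.ringHom_ext (fun r => ?_) fun x => ?_)
  · simp
  · simp only [RingHom.comp_apply, MvPolynomial.coe_eval₂Hom, MvPolynomial.eval₂_X]
    rw [← sub_eq_zero, ← map_sub, Ideal.Quotient.eq_zero_iff_mem, Ideal.mem_span_singleton]
    exact h _ _ _

/-- The torsion equation is multiplied by the regular element `ϖ`, which trades the Christoffel
symbols for `Λ - 1` and the scalar `c` for `ϖ c = p`. -/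
theorem PiConnection.isLeviCivita_iff [IsDomain S] (hp0 : (p : S) ≠ 0) {c : S}
    (hc : c * ϖ = (p : S)) (D : PiConnection p s ϖ φ n) (q : GL (Fin n) S)
    (L : TorsionSymbol p S n) :
    D.IsLeviCivita q (L.scale c) ↔
      (∀ i, (D.Lam i)ᵀ * twistedMetric p s (φ i) q * D.Lam i = metricPow p s q) ∧
        ∀ i j k, (D.Lam i - 1) k j - (D.Lam j - 1) k i =
          algebraMap S (GLComp p S n) ϖ * (algebraMap S _ c * evalY D.Lam (L.mat k i j)) := by
  refine and_congr (D.isMetric_iff q)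
    (forall_congr' fun i => forall_congr' fun j => forall_congr' fun k => ?_)
  have e1 : ∀ i k j, (D.Lam i - 1) k j = algebraMap S (GLComp p S n) ϖ * D.Gam i j k :=
    fun i k j => by
      rw [D.Lam_eq, add_sub_cancel_left, Matrix.smul_apply, Matrix.transpose_apply, smul_eq_mul]
  have e2 : evalY D.Lam ((L.scale c).mat k i j) =
      algebraMap S _ c * evalY D.Lam (L.mat k i j) := by
    rw [← evalY_algebraMap D.Lam, ← map_mul]
    rfl
  rw [e1, e1, e2, ← mul_sub]
  refine ⟨fun H => by rw [H], fun H => ?_⟩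
  rw [← sub_eq_zero] at H ⊢
  exact eq_zero_of_algebraMap_mul hp0 (Dvd.intro_left _ hc) _ (by rw [mul_sub, H])

theorem existsUnique_leviCivita_Lam {φ : Fin N → S →+* S} [IsDomain S] (hp : Odd p)
    (hp0 : (p : S) ≠ 0) {c : S}
    (hc : c * ϖ = (p : S)) {e : ℕ} (he : (p : S) ∣ ϖ ^ e) (hφ : ∀ i, IsFrobLift p s ϖ (φ i))
    {q : GL (Fin N) S} (hq : q.val.IsSymm) (L : TorsionSymbol p S N) :
    ∃! Λ : Fin N → Matrix (Fin N) (Fin N) (GLComp p S N),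
      (∀ i, MatDvd (algebraMap S (GLComp p S N) ϖ) (Λ i - 1)) ∧
      (∀ i, (Λ i)ᵀ * twistedMetric p s (φ i) q * Λ i = metricPow p s q) ∧
        ∀ i j k, (Λ i - 1) k j - (Λ j - 1) k i =
          algebraMap S (GLComp p S N) ϖ * (algebraMap S _ c * evalY Λ (L.mat k i j)) := by
  have hϖ : ϖ ∣ (p : S) := Dvd.intro_left _ hc
  have hη : algebraMap S (GLComp p S N) ϖ ∣ (p : GLComp p S N) := by
    simpa using map_dvd (algebraMap S (GLComp p S N)) hϖ
  refine existsUnique_leviCivita (e := e) hη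
    (by simpa using map_dvd (algebraMap S (GLComp p S N)) he)
    (eq_zero_of_algebraMap_mul hp0 hϖ) (PComp.isUnit_two hp)
    (fun i => transpose_twistedMetric _ hq)
    (transpose_metricPow hq) (isUnit_det_metricPow q)
    (fun i => matDvd_metricPow_sub_twistedMetric hϖ (hφ i) q)
    (ℓ := fun Λ i j k => algebraMap S _ c * evalY Λ (L.mat k i j)) (fun Λ i j k => ?_)
    fun m Λ Λ' h i j k => ?_
  · have : L.mat k i j = -L.mat k j i := congrFun (congrFun (L.antisymm k) j) i
    rw [this, map_neg, mul_neg]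
  · rw [← mul_sub]
    exact (dvd_evalY_sub (pow_dvd_pow_of_dvd hη m) h _).mul_left _

end Existence

/-! ### The gauge group and entrywise powers. -/

section Gauge

variable {N : ℕ}

/-- Each entry of the product is a single term, so no cross terms arise when taking the power. -/
theorem entryPow_mul_of_row {D : Type*} [CommRing D] {g : Matrix (Fin N) (Fin N) D}
    (hg : ∀ a, ∃ b, ∀ b', b' ≠ b → g a b' = 0) (X : Matrix (Fin N) (Fin N) D) {m : ℕ}
    (hm : m ≠ 0) : entryPow (g * X) m = entryPow g m * entryPow X m := by
  refine Matrix.ext fun a c => ?_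
  obtain ⟨b, hb⟩ := hg a
  simp only [entryPow, Matrix.map_apply, Matrix.mul_apply]
  rw [Finset.sum_eq_single b, Finset.sum_eq_single b, mul_pow]
  · exact fun b' _ h => by rw [hb b' h, zero_pow hm, zero_mul]
  · simp
  · exact fun b' _ h => by rw [hb b' h, zero_mul]
  · simp

theorem entryPow_one {D : Type*} [CommRing D] {m : ℕ} (hm : m ≠ 0) :
    entryPow (1 : Matrix (Fin N) (Fin N) D) m = 1 := by
  refine Matrix.ext fun a b => ?_
  by_cases h : a = b <;> simp [entryPow, Matrix.one_apply, h, hm]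

variable {R S : Type*} [CommRing R] [CommRing S] [Algebra R S]

/-- Stated for all `X`, the property is stable under products and inverses, so it need only be
checked on generators, which have at most one nonzero entry in each row. -/
theorem entryPow_gaugeGroup_mul {g : GL (Fin N) S} (hg : g ∈ gaugeGroup R (S := S) N)
    {D : Type*} [CommRing D] (f : S →+* D) {m : ℕ} (hm : m ≠ 0) (X : Matrix (Fin N) (Fin N) D) :
    entryPow (g.val.map f * X) m = entryPow (g.val.map f) m * entryPow X m := by
  induction hg using Subgroup.closure_induction generalizing X with
  | mem g hg =>
    refine entryPow_mul_of_row (fun a => ?_) X hm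
    rcases hg with ⟨σ, hσ⟩ | ⟨d, -, hd⟩
    · refine ⟨σ a, fun b' h => ?_⟩
      rw [Matrix.map_apply, hσ, Equiv.Perm.permMatrix, PEquiv.toMatrix_apply, if_neg, map_zero]
      simpa [eq_comm] using h
    · refine ⟨a, fun b' h => ?_⟩
      rw [Matrix.map_apply, hd, Matrix.diagonal_apply_ne _ h.symm, map_zero]
  | one => simp [entryPow_one hm]
  | mul g h _ _ ihg ihh =>
    rw [Units.val_mul, Matrix.map_mul, mul_assoc, ihg, ihh, ihg, mul_assoc]
  | inv g _ ih =>
    have h1 : g.val.map f * g⁻¹.val.map f = 1 := by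
      rw [← Matrix.map_mul, ← Units.val_mul, mul_inv_cancel]; simp
    have h2 := ih (g⁻¹.val.map f)
    have h3 := ih (g⁻¹.val.map f * X)
    rw [h1, entryPow_one hm] at h2
    rw [← mul_assoc, h1, one_mul] at h3
    rw [h3, ← mul_assoc, mul_eq_one_comm.mp h2.symm, one_mul]

/-- Both sides are multiplicative on the gauge group. On generators the entries are 0, 1 or roots of
unity from `R`. -/
theorem map_eq_entryPow_of_mem_gaugeGroup {g : GL (Fin N) S} (hg : g ∈ gaugeGroup R (S := S) N)
    {φ : S →+* S} {m : ℕ} (hm : m ≠ 0)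
    (hφ : ∀ d : R, IsOfFinOrder d → φ (algebraMap R S d) = algebraMap R S d ^ m) :
    g.val.map φ = entryPow g.val m := by
  have hmul : ∀ g ∈ gaugeGroup R (S := S) N, ∀ X : Matrix (Fin N) (Fin N) S,
      entryPow (g.val * X) m = entryPow g.val m * entryPow X m := fun g hg X => by
    simpa using entryPow_gaugeGroup_mul hg (RingHom.id S) hm X
  induction hg using Subgroup.closure_induction with
  | mem g hg =>
    refine Matrix.ext fun a b => ?_
    rcases hg with ⟨σ, hσ⟩ | ⟨d, hd, hgd⟩
    · simp only [entryPow, Matrix.map_apply, hσ, Equiv.Perm.permMatrix, PEquiv.toMatrix_apply]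
      split_ifs <;> simp [hm]
    · simp only [entryPow, Matrix.map_apply, hgd, Matrix.diagonal_apply]
      split_ifs
      · exact hφ _ (hd a)
      · simp [hm]
  | one => simp [entryPow_one hm]
  | mul g h hg _ ihg ihh => rw [Units.val_mul, Matrix.map_mul, hmul g hg, ihg, ihh]
  | inv g hg ih =>
    have h1 : g.val.map φ * g⁻¹.val.map φ = 1 := by
      rw [← Matrix.map_mul, ← Units.val_mul, mul_inv_cancel]; simp
    have h2 := hmul g hg g⁻¹.val
    rw [← Units.val_mul, mul_inv_cancel, Units.val_one, entryPow_one hm] at h2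
    rw [ih] at h1
    exact (left_inv_eq_right_inv (mul_eq_one_comm.mp h1) h2.symm)

end Gauge

/-! ### Invariance of the equations under the twisted action, and descent. -/

section Compatibility

variable {p s : ℕ} [Fact p.Prime] {N n : ℕ} {R S : Type*} [CommRing R] [CommRing S] [Algebra R S]
  {T : Subgroup (S ≃ₐ[R] S)} {u : T →* gaugeGroup R (S := S) N} {ϖ : S}

theorem twistedAction_algebraMap (τ : T) (a : S) :
    twistedAction p u τ (algebraMap S _ a) = algebraMap S _ (τ.1 a) :=
  glEval_algebraMap _ _ a

theorem map_twistedAction_genX (τ : T) : (genX p N).val.map (twistedAction p u τ) =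
    ((u τ).1⁻¹).val.map (algebraMap S (GLComp p S N)) * (genX p N).val :=
  map_glEval_genX _ _

theorem prime_pow_ne_zero : p ^ s ≠ 0 := pow_ne_zero _ (Fact.out : p.Prime).ne_zero

theorem map_twistedAction_genXPow {φ : S →+* S}
    (hζ : ∀ d : R, IsOfFinOrder d → φ (algebraMap R S d) = algebraMap R S d ^ p ^ s) (τ : T) :
    (genXPow p N s).val.map (twistedAction p u τ) =
      ((u τ).1⁻¹).val.map ((algebraMap S (GLComp p S N)).comp φ) * (genXPow p N s).val := by
  have hm : (u τ).1⁻¹ ∈ gaugeGroup R (S := S) N := inv_mem (u τ).2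
  rw [genXPow_val, entryPow_map, map_twistedAction_genX,
    entryPow_gaugeGroup_mul hm _ prime_pow_ne_zero, ← entryPow_map,
    ← map_eq_entryPow_of_mem_gaugeGroup hm prime_pow_ne_zero hζ, Matrix.map_map, RingHom.coe_comp]

theorem transpose_inv_mul_mul {D : Type*} [CommRing D] (g : GL (Fin N) S) (f : S →+* D)
    (q : Matrix (Fin N) (Fin N) S) :
    (g⁻¹.val.map f)ᵀ * (g.valᵀ * q * g.val).map f * g⁻¹.val.map f = q.map f := by
  have h1 : g.val.map f * g⁻¹.val.map f = 1 := by
    rw [← Matrix.map_mul, ← Units.val_mul, mul_inv_cancel]; simp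
  have h2 : (g⁻¹.val.map f)ᵀ * (g.val.map f)ᵀ = 1 := by
    rw [← Matrix.transpose_mul, h1, Matrix.transpose_one]
  rw [Matrix.map_mul, Matrix.map_mul, Matrix.transpose_map, mul_assoc, mul_assoc, mul_assoc, h1,
    mul_one, ← mul_assoc, h2, one_mul]

/-- Already `xᵗ q x` is invariant: the factor `u⁻¹` picked up by `x` cancels `τ(q) = uᵗ q u`. -/
theorem map_twistedAction_metricPow {q : GL (Fin N) S} (hu : IsCompatibleMetric u q) (τ : T) :
    (metricPow p s q).map (twistedAction p u τ) = metricPow p s q := by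
  have h : (q.val.map (algebraMap S (GLComp p S N))).map (twistedAction p u τ) =
      ((u τ).1.valᵀ * q.val * (u τ).1.val).map (algebraMap S (GLComp p S N)) := by
    rw [← hu τ]
    exact Matrix.ext fun a b => twistedAction_algebraMap τ _
  rw [metricPow, entryPow_map, Matrix.map_mul, Matrix.map_mul, Matrix.transpose_map,
    map_twistedAction_genX, h, Matrix.transpose_mul,
    ← transpose_inv_mul_mul (u τ).1 (algebraMap S (GLComp p S N)) q.val]
  simp only [mul_assoc]

/-- The action of `τ'` on `φ(q)` is `φ(τ(q)) = φ(uᵗ q u)`, while `x^(p ^ s)` picks up `φ(u⁻¹)`.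
Invariance of the cocycle ensures that the two values of `u` agree. -/
theorem map_twistedAction_twistedMetric {q : GL (Fin N) S} (hu : IsCompatibleMetric u q)
    {φ : S →+* S}
    (hζ : ∀ d : R, IsOfFinOrder d → φ (algebraMap R S d) = algebraMap R S d ^ p ^ s)
    {τ τ' : T} (hτ : IsConjBy φ τ.1 τ'.1) (huτ : u τ' = u τ) :
    (twistedMetric p s φ q).map (twistedAction p u τ') = twistedMetric p s φ q := by
  have h : (q.val.map ((algebraMap S (GLComp p S N)).comp φ)).map (twistedAction p u τ') =
      ((u τ').1.valᵀ * q.val * (u τ').1.val).map ((algebraMap S (GLComp p S N)).comp φ) := by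
    rw [huτ, ← hu τ]
    refine Matrix.ext fun a b => ?_
    simp only [Matrix.map_apply, RingHom.comp_apply]
    rw [twistedAction_algebraMap, ← hτ]
  rw [twistedMetric, Matrix.map_mul, Matrix.map_mul, Matrix.transpose_map,
    map_twistedAction_genXPow hζ, h, Matrix.transpose_mul]
  conv_rhs => rw [← transpose_inv_mul_mul (u τ').1 ((algebraMap S (GLComp p S N)).comp φ) q.val]
  simp only [mul_assoc]

variable {φ : Fin n → S →+* S}

/-- Both composites send `x` to `φ(u⁻¹) x^(p ^ s) Λ`, once `Λ` is fixed by the action. -/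
theorem isCompatibleConnection_of_map_Lam
    (hζ : ∀ i, ∀ d : R, IsOfFinOrder d → φ i (algebraMap R S d) = algebraMap R S d ^ p ^ s)
    (hinv : IsInvariantCocycle φ u) {D : PiConnection p s ϖ φ N}
    (h : ∀ τ i, (D.Lam i).map (twistedAction p u τ) = D.Lam i) : IsCompatibleConnection u D := by
  intro i τ τ' hτ
  refine glHom_ext ?_ ?_
  · ext1 a
    simp only [RingHom.comp_apply]
    rw [twistedAction_algebraMap, D.lift_algebraMap, D.lift_algebraMap, twistedAction_algebraMap,
      hτ]
  · rw [RingHom.coe_comp, RingHom.coe_comp, ← Matrix.map_map, ← Matrix.map_map,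
      map_twistedAction_genX, Matrix.map_mul, D.map_lift_genX, Matrix.map_mul, h,
      map_twistedAction_genXPow (hζ i), hinv i τ τ' hτ, Matrix.map_map, ← RingHom.coe_comp,
      D.extends_base, mul_assoc]

theorem mem_torsorRing {f : GLComp p S N} :
    f ∈ torsorRing p u ↔ ∀ τ, twistedAction p u τ f = f := by
  simp [torsorRing, Subring.mem_iInf, RingHom.mem_eqLocus]

theorem mem_baseInvariants {a : S} : a ∈ baseInvariants T ↔ ∀ τ : T, τ.1 a = a := by
  simp [baseInvariants, Subring.mem_iInf, RingHom.mem_eqLocus]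

theorem descendsToTorsor_of_isCompatibleConnection (hT : ∀ i, Normalizes (φ i) T)
    {D : PiConnection p s ϖ φ N} (h : IsCompatibleConnection u D) : DescendsToTorsor D u := by
  intro i
  have h1 : ∀ f : torsorRing p u, D.lift i f ∈ torsorRing p u := fun f => by
    refine mem_torsorRing.mpr fun τ' => ?_
    -- Invariance under `τ'` is tested by writing `τ' φ = φ τ`, so the inclusion `T ⊆ φ T φ⁻¹` is
    -- the one needed.
    obtain ⟨τ, hτ, hc⟩ := (hT i).2 τ'.1 τ'.2
    have := congrArg (fun e : GLComp p S N →+* GLComp p S N => e f) (h i ⟨τ, hτ⟩ τ' hc)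
    simp only [RingHom.comp_apply] at this
    rw [← this, mem_torsorRing.mp f.2]
  have h2 : ∀ a : baseInvariants T, φ i a ∈ baseInvariants T := fun a => by
    refine mem_baseInvariants.mpr fun τ' => ?_
    obtain ⟨τ, hτ, hc⟩ := (hT i).2 τ'.1 τ'.2
    rw [← hc, mem_baseInvariants.mp a.2 ⟨τ, hτ⟩]
  refine ⟨((D.lift i).comp (torsorRing p u).subtype).codRestrict _ h1,
    ((φ i).comp (baseInvariants T).subtype).codRestrict _ h2, fun f => rfl, fun a => rfl,
    fun f => D.isFrobLift i f, fun a f hf => ?_⟩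
  change D.lift i f = algebraMap S _ (φ i a)
  rw [hf, D.lift_algebraMap]

theorem exists_isConjBy (hT : ∀ i, Normalizes (φ i) T) (hinv : IsInvariantCocycle φ u) (i : Fin n)
    (τ' : T) : ∃ τ : T, IsConjBy (φ i) τ.1 τ'.1 ∧ u τ' = u τ := by
  obtain ⟨τ, hτ, hc⟩ := (hT i).2 τ'.1 τ'.2
  exact ⟨⟨τ, hτ⟩, hc, hinv i ⟨τ, hτ⟩ τ' hc⟩

theorem matDvd_map_twistedAction {τ : T} (hτ : ϖ ∣ τ.1 ϖ)
    {M : Matrix (Fin N) (Fin N) (GLComp p S N)} (h : MatDvd (algebraMap S _ ϖ) (M - 1)) :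
    MatDvd (algebraMap S _ ϖ) (M.map (twistedAction p u τ) - 1) := by
  have h1 := h.map (twistedAction p u τ)
  rw [twistedAction_algebraMap, Matrix.map_sub _ (map_sub _), Matrix.map_one _ (map_zero _)
    (map_one _)] at h1
  exact fun a b => (map_dvd _ hτ).trans (h1 a b)

/-- The transported `Λ` solves the same Chern equations, hence equals `Λ`. -/
theorem PiConnection.IsChern.isCompatibleConnection [IsDomain S] (hp : Odd p) (hp0 : (p : S) ≠ 0)
    (hϖ : ϖ ∣ (p : S)) {e : ℕ} (he : (p : S) ∣ ϖ ^ e) (hφ : ∀ i, IsFrobLift p s ϖ (φ i))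
    (hζ : ∀ i, ∀ d : R, IsOfFinOrder d → φ i (algebraMap R S d) = algebraMap R S d ^ p ^ s)
    (hϖT : ∀ τ : T, ϖ ∣ τ.1 ϖ) (hT : ∀ i, Normalizes (φ i) T) (hinv : IsInvariantCocycle φ u)
    {q : GL (Fin N) S} (hq : q.val.IsSymm) (hu : IsCompatibleMetric u q)
    {D : PiConnection p s ϖ φ N} (hD : D.IsChern q) : IsCompatibleConnection u D := by
  refine isCompatibleConnection_of_map_Lam hζ hinv fun τ => ?_
  rw [D.isChern_iff] at hD
  have hA : ∀ i, (twistedMetric p s (φ i) q).map (twistedAction p u τ) =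
      twistedMetric p s (φ i) q := fun i => by
    obtain ⟨τ₀, hc, hcu⟩ := exists_isConjBy hT hinv i τ
    exact map_twistedAction_twistedMetric hu (hζ i) hc hcu
  refine fun i => congrFun ((existsUnique_chern_Lam (n := n) hp hp0 hϖ he hφ hq).unique
    (y₁ := fun i => (D.Lam i).map (twistedAction p u τ)) ⟨fun i => ?_, fun i => ?_, fun i => ?_⟩
    ⟨D.matDvd_Lam_sub_one, hD⟩) i
  · exact matDvd_map_twistedAction (hϖT τ) (D.matDvd_Lam_sub_one i)
  · have := congrArg (fun M => M.map (twistedAction p u τ)) (hD.1 i)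
    simpa only [Matrix.map_mul, Matrix.transpose_map, hA] using this
  · have := congrArg (fun M => M.map (twistedAction p u τ)) (hD.2 i)
    simpa only [Matrix.map_mul, Matrix.transpose_map, hA, map_twistedAction_metricPow hu] using this

/-- The coefficients of `F` come from `R`, on which `τ` acts trivially. -/
theorem twistedAction_evalY_baseChange (τ : T)
    (Y : Fin N → Matrix (Fin N) (Fin N) (GLComp p S N)) (F : YComp p R N) :
    twistedAction p u τ (evalY Y (PComp.map (MvPolynomial.map (algebraMap R S)) F)) =
      evalY (fun i => (Y i).map (twistedAction p u τ))
        (PComp.map (MvPolynomial.map (algebraMap R S)) F) := by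
  refine congrArg (fun e : YComp p R N →+* GLComp p S N => e F) (PComp.hom_ext
    (f := (twistedAction p u τ).comp ((evalY Y).comp
      (PComp.map (MvPolynomial.map (algebraMap R S)))))
    (g := (evalY fun i => (Y i).map (twistedAction p u τ)).comp
      (PComp.map (MvPolynomial.map (algebraMap R S)))) ?_)
  refine MvPolynomial.ringHom_ext (fun r => ?_) fun x => ?_
  · simp only [RingHom.comp_apply, PComp.map, PComp.lift_algebraMap, evalY, MvPolynomial.map_C,
      MvPolynomial.coe_eval₂Hom, MvPolynomial.eval₂_C, twistedAction_algebraMap, AlgEquiv.commutes]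
  · simp only [RingHom.comp_apply, PComp.map, PComp.lift_algebraMap, evalY, MvPolynomial.map_X,
      MvPolynomial.coe_eval₂Hom, MvPolynomial.eval₂_X, Matrix.map_apply]

theorem PiConnection.IsLeviCivita.isCompatibleConnection {φ : Fin N → S →+* S} [IsDomain S]
    (hp : Odd p) (hp0 : (p : S) ≠ 0) {c : S} (hc : c * ϖ = (p : S)) {e : ℕ} (he : (p : S) ∣ ϖ ^ e)
    (hφ : ∀ i, IsFrobLift p s ϖ (φ i))
    (hζ : ∀ i, ∀ d : R, IsOfFinOrder d → φ i (algebraMap R S d) = algebraMap R S d ^ p ^ s)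
    (hϖT : ∀ τ : T, ϖ ∣ τ.1 ϖ) (hT : ∀ i, Normalizes (φ i) T) (hinv : IsInvariantCocycle φ u)
    {q : GL (Fin N) S} (hq : q.val.IsSymm) (hu : IsCompatibleMetric u q) (L : TorsionSymbol p R N)
    {D : PiConnection p s ϖ φ N} (hD : D.IsLeviCivita q ((L.baseChange S).scale c)) :
    IsCompatibleConnection u D := by
  refine isCompatibleConnection_of_map_Lam hζ hinv fun τ => ?_
  rw [D.isLeviCivita_iff hp0 hc] at hD
  have hA : ∀ i, (twistedMetric p s (φ i) q).map (twistedAction p u τ) =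
      twistedMetric p s (φ i) q := fun i => by
    obtain ⟨τ₀, hc, hcu⟩ := exists_isConjBy hT hinv i τ
    exact map_twistedAction_twistedMetric hu (hζ i) hc hcu
  refine fun i => congrFun ((existsUnique_leviCivita_Lam hp hp0 hc he hφ hq
    (L.baseChange S)).unique
    (y₁ := fun i => (D.Lam i).map (twistedAction p u τ))
    ⟨fun i => ?_, fun i => ?_, fun i j k => ?_⟩ ⟨D.matDvd_Lam_sub_one, hD⟩) i
  · exact matDvd_map_twistedAction (hϖT τ) (D.matDvd_Lam_sub_one i)
  · have := congrArg (fun M => M.map (twistedAction p u τ)) (hD.1 i)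
    simpa only [Matrix.map_mul, Matrix.transpose_map, hA, map_twistedAction_metricPow hu] using this
  · have h1 : ∀ y, algebraMap S (GLComp p S N) ϖ * (algebraMap S _ c * y) =
        (p : GLComp p S N) * y := fun y => by
      rw [← mul_assoc, ← map_mul, mul_comm ϖ, hc, map_natCast]
    have h2 : ∀ i, (D.Lam i).map (twistedAction p u τ) - 1 =
        (D.Lam i - 1).map (twistedAction p u τ) := fun i => by
      rw [Matrix.map_sub _ (map_sub _), Matrix.map_one _ (map_zero _) (map_one _)]
    have h3 := congrArg (twistedAction p u τ) (hD.2 i j k)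
    rw [h1, map_sub, map_mul, map_natCast] at h3
    rw [h1, h2, h2]
    refine h3.trans (congrArg _ ?_)
    exact twistedAction_evalY_baseChange τ _ _

end Compatibility

/-! ### Finite domains over the `p`-adic integers. -/

section FiniteOverPadic

/-- A finite module over a ring that is complete for a principal ideal is complete as well. -/
theorem isPrecomplete_of_finite {A M : Type*} [CommRing A] [AddCommGroup M] [Module A M]
    [Module.Finite A M] (a : A) [IsPrecomplete (Ideal.span {a}) A] :
    IsPrecomplete (Ideal.span {a}) M := by
  obtain ⟨r, b, hb⟩ := Module.Finite.exists_fin (R := A) (M := M)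
  have hsmul : ∀ m : ℕ, ∀ x : M, x ∈ (Ideal.span {a} ^ m • ⊤ : Submodule A M) ↔ ∃ y, x = a ^ m • y := by
    intro m x
    rw [Ideal.span_singleton_pow, Submodule.ideal_span_singleton_smul,
      Submodule.mem_smul_pointwise_iff_exists]
    simp [eq_comm]
  refine ⟨fun f hf => ?_⟩
  have hc : ∀ m, ∃ c : Fin r → A, f (m + 1) - f m = a ^ m • ∑ j, c j • b j := by
    intro m
    have h := (hf m.le_succ).symm
    rw [SModEq.sub_mem, hsmul] at h
    obtain ⟨y, hy⟩ := h
    obtain ⟨c, hc⟩ := (Submodule.mem_span_range_iff_exists_fun A).mp (hb ▸ Submodule.mem_top (x := y))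
    exact ⟨c, by rw [hc, ← hy]⟩
  choose c hc using hc
  -- Successive differences are expanded in the generators `b j`. The resulting coefficient series
  -- converge in `A`, and their sums give the limit in `M`.
  have hlim : ∀ j, ∃ L : A, ∀ m, ∃ d, (∑ i ∈ Finset.range m, a ^ i * c i j) - L = a ^ m * d := by
    intro j
    obtain ⟨L, hL⟩ := IsPrecomplete.prec (I := Ideal.span {a}) (M := A) ‹_›
      (f := fun m => ∑ i ∈ Finset.range m, a ^ i * c i j) (by
        intro m n hmn
        rw [SModEq.sub_mem, smul_eq_mul, Ideal.mul_top, Ideal.span_singleton_pow,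
          Ideal.mem_span_singleton, ← dvd_neg, neg_sub, Finset.sum_range_sub_sum_range hmn]
        refine Finset.dvd_sum fun i hi => Dvd.dvd.mul_right (pow_dvd_pow _ ?_) _
        exact (Finset.mem_filter.mp hi).2)
    refine ⟨L, fun m => ?_⟩
    have := hL m
    rwa [SModEq.sub_mem, smul_eq_mul, Ideal.mul_top, Ideal.span_singleton_pow,
      Ideal.mem_span_singleton] at this
  choose L hL using hlim
  have hf' : ∀ m, f m = f 0 + ∑ j, (∑ i ∈ Finset.range m, a ^ i * c i j) • b j := by
    intro m
    induction m with
    | zero => simp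
    | succ m ih =>
      rw [← sub_add_cancel (f (m + 1)) (f m), hc, ih]
      simp only [Finset.sum_range_succ, add_smul, Finset.sum_add_distrib, mul_smul,
        ← Finset.smul_sum]
      abel
  refine ⟨f 0 + ∑ j, L j • b j, fun m => ?_⟩
  rw [SModEq.sub_mem, hsmul, hf' m]
  choose d hd using fun j => hL j m
  refine ⟨∑ j, d j • b j, ?_⟩
  rw [add_sub_add_left_eq_sub, ← Finset.sum_sub_distrib, Finset.smul_sum]
  exact Finset.sum_congr rfl fun j _ => by rw [← sub_smul, hd, mul_smul]

variable {p : ℕ} [Fact p.Prime] {O : Type*} [CommRing O] [IsDomain O] [Algebra ℤ_[p] O]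
  [Module.Finite ℤ_[p] O] {ϖ : O}

/-- By integrality the ideal of `ϖ` contains a nonzero `p`-adic integer, that is, a unit times a
power of `p`. -/
theorem dvd_natCast_of_prime (hϖ : Prime ϖ) : ϖ ∣ (p : O) := by
  have h := Ideal.comap_ne_bot_of_integral_mem (R := ℤ_[p]) hϖ.ne_zero
    (Ideal.mem_span_singleton_self ϖ) (Algebra.IsIntegral.isIntegral ϖ)
  obtain ⟨c, hc, hc0⟩ := Submodule.exists_mem_ne_zero_of_ne_bot h
  rw [Ideal.mem_comap, Ideal.mem_span_singleton, PadicInt.unitCoeff_spec hc0, map_mul, map_pow,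
    map_natCast] at hc
  rcases hϖ.dvd_or_dvd hc with h1 | h1
  · exact absurd (isUnit_of_dvd_unit h1 ((PadicInt.unitCoeff hc0).isUnit.map _)) hϖ.not_isUnit
  · exact hϖ.dvd_of_dvd_pow h1

theorem isAdicComplete_of_finite_padicInt (hϖ : Prime ϖ) :
    IsAdicComplete (Ideal.span {(p : O)}) O := by
  have h0 : IsAdicComplete (Ideal.span {(p : ℤ_[p])}) ℤ_[p] := by
    rw [← PadicInt.maximalIdeal_eq_span_p]; infer_instance
  have h1 : IsPrecomplete (Ideal.span {(p : ℤ_[p])}) O := isPrecomplete_of_finite _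
  rw [← IsPrecomplete.map_algebraMap_iff (S := O), Ideal.map_span, Set.image_singleton,
    map_natCast] at h1
  have : IsNoetherianRing O := IsNoetherianRing.of_finite ℤ_[p] O
  have h2 : IsHausdorff (Ideal.span {(p : O)}) O := by
    refine IsHausdorff.of_isDomain _ fun h => hϖ.not_isUnit ?_
    rw [Ideal.span_singleton_eq_top] at h
    exact isUnit_of_dvd_unit (dvd_natCast_of_prime hϖ) h
  exact { toIsHausdorff := h2, toIsPrecomplete := h1 }

variable (p O) in
omit [IsDomain O] in
theorem finite_quotient_padicInt : Finite (O ⧸ Ideal.span {(p : O)}) := by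
  obtain ⟨r, b, hb⟩ := Module.Finite.exists_fin (R := ℤ_[p]) (M := O)
  refine Finite.of_surjective
    (fun f : Fin r → Fin p => Ideal.Quotient.mk (Ideal.span {(p : O)}) (∑ j, ((f j : ℕ) : O) * b j))
    fun y => ?_
  obtain ⟨x, rfl⟩ := Ideal.Quotient.mk_surjective y
  obtain ⟨c, rfl⟩ := (Submodule.mem_span_range_iff_exists_fun ℤ_[p]).mp
    (hb ▸ Submodule.mem_top (x := x))
  choose f hf hfc using fun j => PadicInt.exists_mem_range (c j)
  refine ⟨fun j => ⟨f j, hf j⟩, ?_⟩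
  rw [← sub_eq_zero, ← map_sub, Ideal.Quotient.eq_zero_iff_mem, ← Finset.sum_sub_distrib]
  refine Ideal.sum_mem _ fun j _ => ?_
  have h := hfc j
  rw [PadicInt.maximalIdeal_eq_span_p, Ideal.mem_span_singleton] at h
  have h' := map_dvd (algebraMap ℤ_[p] O) h
  rw [Algebra.smul_def, ← sub_mul, Ideal.mem_span_singleton, ← dvd_neg, ← neg_mul, neg_sub]
  exact Dvd.dvd.mul_right (by simpa using h') _

theorem exists_pow_isIdempotentElem {B : Type*} [Monoid B] [Finite B] (x : B) :
    ∃ k, 0 < k ∧ x ^ k * x ^ k = x ^ k := by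
  obtain ⟨i, j, hne, hij⟩ := Finite.exists_ne_map_eq_of_infinite fun m : ℕ => x ^ m
  wlog h : i < j generalizing i j
  · exact this j i hne.symm hij.symm (by omega)
  obtain ⟨d, rfl⟩ := Nat.exists_eq_add_of_lt h
  have h1 : ∀ m k, i ≤ k → x ^ (k + (d + 1) * m) = x ^ k := by
    intro m k hk
    induction m with
    | zero => simp
    | succ m ih =>
      obtain ⟨l, rfl⟩ := Nat.exists_eq_add_of_le hk
      rw [← ih, show i + l + (d + 1) * (m + 1) = (i + d + 1) + (l + (d + 1) * m) by ring, pow_add,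
        ← hij, ← pow_add, add_assoc]
  -- A positive multiple of the period `d + 1` that lies beyond the preperiod `i`.
  refine ⟨(d + 1) * (i + 1), by positivity, ?_⟩
  rw [← pow_add, h1 _ _ (by nlinarith)]

/-- Some power of `ϖ` is idempotent in the finite ring `O / p` and lifts by Hensel's lemma to an
idempotent of the domain `O`. The lift is 0, which is the claim, or 1, in which case `ϖ` would be a
unit. -/
theorem natCast_dvd_pow_of_prime (hϖ : Prime ϖ) : ∃ k, (p : O) ∣ ϖ ^ k := by
  have := isAdicComplete_of_finite_padicInt (p := p) hϖ
  have := finite_quotient_padicInt p O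
  obtain ⟨k, hk, hidem⟩ :=
    exists_pow_isIdempotentElem (Ideal.Quotient.mk (Ideal.span {(p : O)}) ϖ)
  rw [← map_pow] at hidem
  obtain ⟨ε, hε, hε'⟩ := HenselianRing.is_henselian (I := Ideal.span {(p : O)})
    (Polynomial.X ^ 2 - Polynomial.X : Polynomial O)
    (Polynomial.monic_X_pow_sub (by rw [Polynomial.degree_X]; norm_num)) (ϖ ^ k) (by
      rw [← Ideal.Quotient.eq_zero_iff_mem]
      simp only [Polynomial.eval_sub, Polynomial.eval_pow, Polynomial.eval_X, map_sub]
      rw [pow_two, map_mul, hidem, sub_self]) (by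
      simp only [Polynomial.derivative_X_pow, Polynomial.derivative_X,
        Polynomial.eval_sub, Polynomial.eval_mul, Polynomial.eval_pow, Polynomial.eval_X,
        Polynomial.eval_one, map_sub, map_mul, map_one, Polynomial.eval_C]
      -- The derivative `2 X - 1` at an idempotent is its own inverse.
      refine IsUnit.of_mul_eq_one (2 * Ideal.Quotient.mk (Ideal.span {(p : O)}) (ϖ ^ k) - 1) ?_
      norm_num [← map_pow, map_ofNat]
      linear_combination 4 * hidem)
  have h2 : ε * (ε - 1) = 0 := by
    have : ε ^ 2 - ε = 0 := by simpa [Polynomial.IsRoot] using hε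
    linear_combination this
  rw [Ideal.mem_span_singleton] at hε'
  rcases mul_eq_zero.mp h2 with rfl | h3
  · exact ⟨k, by simpa using hε'⟩
  · obtain rfl := sub_eq_zero.mp h3
    refine absurd (isUnit_of_dvd_one ?_) hϖ.not_isUnit
    have h4 := dvd_add ((dvd_natCast_of_prime (p := p) hϖ).trans hε') (dvd_pow_self ϖ hk.ne')
    rwa [sub_add_cancel] at h4

/-- Teichmüller representatives in a finite extension of `ℤ_p`. -/
theorem exists_teichmuller (hϖ : Prime ϖ) (a : O) :
    ∃ f ω, 0 < f ∧ ω ^ p ^ f = ω ∧ ϖ ∣ a - ω := by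
  have := isAdicComplete_of_finite_padicInt (p := p) hϖ
  have := finite_quotient_padicInt p O
  obtain ⟨k, hk⟩ := natCast_dvd_pow_of_prime (p := p) hϖ
  have hϖp := dvd_natCast_of_prime (p := p) hϖ
  have hle : Ideal.span {(p : O)} ≤ Ideal.span {ϖ} :=
    (Ideal.span_singleton_le_span_singleton).mpr hϖp
  have hfin : Finite (O ⧸ Ideal.span {ϖ}) :=
    Finite.of_surjective _ (Ideal.Quotient.factor_surjective hle)
  have hprime : (Ideal.span {ϖ}).IsPrime :=
    (Ideal.span_singleton_prime hϖ.ne_zero).mpr hϖ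
  let _ : Field (O ⧸ Ideal.span {ϖ}) := (Finite.isField_of_domain _).toField
  have : Fintype (O ⧸ Ideal.span {ϖ}) := Fintype.ofFinite _
  have hchar : CharP (O ⧸ Ideal.span {ϖ}) p := by
    refine (CharP.charP_iff_prime_eq_zero Fact.out).mpr ?_
    rw [← map_natCast (Ideal.Quotient.mk (Ideal.span {ϖ})), Ideal.Quotient.eq_zero_iff_mem,
      Ideal.mem_span_singleton]
    exact hϖp
  obtain ⟨f, -, hf⟩ := FiniteField.card (O ⧸ Ideal.span {ϖ}) p
  have hq : ∀ m : ℕ, ϖ ∣ a ^ (p ^ (f : ℕ)) ^ m - a := fun m => by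
    rw [← Ideal.mem_span_singleton, ← Ideal.Quotient.eq_zero_iff_mem, map_sub, map_pow, ← hf,
      FiniteField.pow_card_pow, sub_self]
  have hcharp : CharP (O ⧸ Ideal.span {(p : O)}) p := by
    have : Nontrivial (O ⧸ Ideal.span {(p : O)}) :=
      (Ideal.Quotient.factor_surjective hle).nontrivial
    refine (CharP.charP_iff_prime_eq_zero Fact.out).mpr ?_
    rw [← map_natCast (Ideal.Quotient.mk (Ideal.span {(p : O)})), Ideal.Quotient.eq_zero_iff_mem]
    exact Ideal.mem_span_singleton_self _
  have hkp : k ≤ (p ^ (f : ℕ)) ^ k :=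
    (Nat.lt_pow_self (Nat.one_lt_pow f.pos.ne' (Fact.out : p.Prime).one_lt)).le
  -- With `q = p ^ f` the size of the residue field, `b ^ q - b` is congruent mod `p` to `(a ^ q -
  -- a) ^ (q ^ k)`. This is divisible by `ϖ ^ k`, hence by `p`, so `b` is an approximate root to
  -- which Hensel's lemma modulo `p` applies.
  set b := a ^ (p ^ (f : ℕ)) ^ k with hb
  have hroot : b ^ p ^ (f : ℕ) - b ∈ Ideal.span {(p : O)} := by
    have h1 : (p : O) ∣ (a ^ p ^ (f : ℕ) - a) ^ (p ^ (f : ℕ)) ^ k := by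
      have h1 := hq 1
      rw [pow_one] at h1
      exact hk.trans ((pow_dvd_pow ϖ hkp).trans (pow_dvd_pow_of_dvd h1 _))
    rw [← Ideal.mem_span_singleton, ← Ideal.Quotient.eq_zero_iff_mem, ← pow_mul, map_pow, map_sub,
      sub_pow_char_pow, ← map_pow, ← map_pow, ← map_sub, Ideal.Quotient.eq_zero_iff_mem] at h1
    convert h1 using 2
    · rw [hb, ← pow_mul, ← pow_mul, ← pow_mul, mul_comm]
    · rw [hb, ← pow_mul]
  have hone : 1 < p ^ (f : ℕ) := Nat.one_lt_pow f.pos.ne' (Fact.out : p.Prime).one_lt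
  obtain ⟨ω, hω, hω'⟩ := HenselianRing.is_henselian (I := Ideal.span {(p : O)})
    (Polynomial.X ^ p ^ (f : ℕ) - Polynomial.X : Polynomial O)
    (Polynomial.monic_X_pow_sub (by rw [Polynomial.degree_X]; exact_mod_cast hone)) b
    (by simpa using hroot) (by
      simp [Polynomial.derivative_X_pow, f.pos.ne'])
  refine ⟨f, ω, f.pos, ?_, ?_⟩
  · rw [← sub_eq_zero]
    simpa [Polynomial.IsRoot] using hω
  · rw [Ideal.mem_span_singleton] at hω'
    have := dvd_add (hq k) (hϖp.trans hω')
    rw [← dvd_neg]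
    convert this using 1
    ring

end FiniteOverPadic

/-! ### Roots of unity in the Witt vectors. -/

section Unramified

variable {p : ℕ} [Fact p.Prime]

theorem UnramRing.not_isUnit_natCast : ¬ IsUnit (p : UnramRing p) :=
  (WittVector.irreducible p).not_isUnit

theorem UnramRing.natCast_dvd_of_not_isUnit {r : UnramRing p} (hr : ¬ IsUnit r) :
    (p : UnramRing p) ∣ r := by
  rw [← Ideal.mem_span_singleton, ← (WittVector.irreducible p).maximalIdeal_eq,
    IsLocalRing.mem_maximalIdeal]
  exact hr

theorem UnramRing.natCast_ne_zero : (p : UnramRing p) ≠ 0 := (WittVector.irreducible p).ne_zero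

theorem UnramRing.natCast_dvd_of_coeff_zero {r : UnramRing p} (hr : r.coeff 0 = 0) :
    (p : UnramRing p) ∣ r := by
  refine UnramRing.natCast_dvd_of_not_isUnit fun h => ?_
  have := h.map (WittVector.constantCoeff (p := p) (R := AlgebraicClosure (ZMod p)))
  rw [show WittVector.constantCoeff r = 0 from hr] at this
  exact not_isUnit_zero this

theorem algebraMap_unramClosure_injective :
    Function.Injective (algebraMap (UnramRing p) (UnramClosure p)) := by
  rw [IsScalarTower.algebraMap_eq (UnramRing p) (UnramField p) (UnramClosure p)]
  exact (algebraMap (UnramField p) (UnramClosure p)).injective.comp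
    (IsFractionRing.injective _ _)

/-- `UnramRing p` contains no primitive `p`-th root of unity, as `p` is odd. -/
theorem UnramRing.eq_one_of_pow_prime_eq_one (hp : p ≠ 2) {ζ : UnramRing p} (h : ζ ^ p = 1) :
    ζ = 1 := by
  have hcoeff : (ζ - 1).coeff 0 = 0 := by
    have h1 := congrArg (WittVector.constantCoeff (p := p) (R := AlgebraicClosure (ZMod p))) h
    rw [map_pow, map_one, ← one_pow p] at h1
    have h2 := frobenius_inj (AlgebraicClosure (ZMod p)) p h1
    change WittVector.constantCoeff (ζ - 1) = 0
    rw [map_sub, map_one, h2, sub_self]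
  obtain ⟨a, ha⟩ := UnramRing.natCast_dvd_of_coeff_zero hcoeff
  obtain rfl : ζ = 1 + p * a := by rw [← ha]; ring
  by_contra hne
  have hgeom : ∑ i ∈ Finset.range p, (1 + (p : UnramRing p) * a) ^ i = 0 := by
    have h3 := mul_geom_sum (1 + (p : UnramRing p) * a) p
    rw [h, sub_self] at h3
    exact (mul_eq_zero.mp h3).resolve_left (sub_ne_zero.mpr hne)
  -- To first order in `p * a`, the geometric sum is `p + p a · p(p-1)/2`. For odd `p` the second
  -- term is divisible by `p ^ 2`, so the sum is `p` times an element congruent to 1 mod `p` and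
  -- cannot vanish.
  have hb : ∀ i : ℕ, ∃ b, (1 + (p : UnramRing p) * a) ^ i = 1 + i * (p * a) + p ^ 2 * b := by
    intro i
    induction i with
    | zero => exact ⟨0, by simp⟩
    | succ i ih =>
      obtain ⟨b, hb⟩ := ih
      exact ⟨i * a ^ 2 + b + p * a * b, by rw [pow_succ, hb]; push_cast; ring⟩
  choose b hb using hb
  obtain ⟨m, hm⟩ := (Fact.out : p.Prime).odd_of_ne_two hp
  have hsum : (∑ i ∈ Finset.range p, (i : UnramRing p)) = p * m := by
    have h5 : p * (p - 1) / 2 = p * m := by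
      rw [show p - 1 = 2 * m by omega, show p * (2 * m) = p * m * 2 by ring,
        Nat.mul_div_cancel _ two_pos]
    rw [← Nat.cast_sum, Finset.sum_range_id, h5, Nat.cast_mul]
  have hz : (p : UnramRing p) * (1 + p * (m * a + ∑ i ∈ Finset.range p, b i)) = 0 := by
    rw [← hgeom]
    simp only [hb, Finset.sum_add_distrib, ← Finset.sum_mul, ← Finset.mul_sum, hsum]
    simp
    ring
  have hu := (mul_eq_zero.mp hz).resolve_left UnramRing.natCast_ne_zero
  exact UnramRing.not_isUnit_natCast (IsUnit.of_mul_eq_one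
    (-((m : UnramRing p) * a + ∑ i ∈ Finset.range p, b i)) (by linear_combination -hu))

theorem UnramRing.orderOf_coprime (hp : p ≠ 2) {ζ : UnramRing p} (h : IsOfFinOrder ζ) :
    Nat.Coprime p (orderOf ζ) := by
  rw [Nat.Prime.coprime_iff_not_dvd Fact.out]
  rintro ⟨d, hd⟩
  have h1 : (ζ ^ d) ^ p = 1 := by rw [← pow_mul, mul_comm, ← hd, pow_orderOf_eq_one]
  have h2 := orderOf_dvd_of_pow_eq_one (UnramRing.eq_one_of_pow_prime_eq_one hp h1)
  have h3 := h.orderOf_pos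
  have h4 := (Fact.out : p.Prime).two_le
  rcases Nat.eq_zero_or_pos d with rfl | h0
  · omega
  · have := Nat.le_of_dvd h0 h2
    nlinarith

/-- The roots of `X ^ q - X` in the algebraic closure are Teichmüller elements. -/
theorem exists_algebraMap_eq_of_pow_eq {f : ℕ} (hf : 0 < f) {x : UnramClosure p}
    (hx : x ^ p ^ f = x) : ∃ r : UnramRing p, algebraMap _ (UnramClosure p) r = x := by
  classical
  have hq : 1 < p ^ f := Nat.one_lt_pow hf.ne' (Fact.out : p.Prime).one_lt
  let P : Polynomial (AlgebraicClosure (ZMod p)) := Polynomial.X ^ p ^ f - Polynomial.X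
  let Q : Polynomial (UnramClosure p) := Polynomial.X ^ p ^ f - Polynomial.X
  have hP0 : P ≠ 0 := FiniteField.X_pow_card_sub_X_ne_zero _ hq
  have hQ0 : Q ≠ 0 := FiniteField.X_pow_card_sub_X_ne_zero _ hq
  have hPd : P.natDegree = p ^ f := FiniteField.X_pow_card_sub_X_natDegree_eq _ hq
  have hQd : Q.natDegree = p ^ f := FiniteField.X_pow_card_sub_X_natDegree_eq _ hq
  have hPcard : P.roots.toFinset.card = p ^ f := by
    have hsep : P.Separable := galois_poly_separable p _ (dvd_pow_self p hf.ne')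
    rw [Multiset.toFinset_card_of_nodup (Polynomial.nodup_roots hsep), ← hPd]
    exact (IsAlgClosed.splits P).natDegree_eq_card_roots.symm
  let t : AlgebraicClosure (ZMod p) → UnramClosure p := fun z =>
    algebraMap (UnramRing p) (UnramClosure p) (WittVector.teichmuller p z)
  have ht : Function.Injective t := fun z z' h => by
    have := congrArg (fun w : UnramRing p => w.coeff 0) (algebraMap_unramClosure_injective h)
    simpa using this
  have hsub : P.roots.toFinset.image t ⊆ Q.roots.toFinset := by
    intro y hy
    obtain ⟨z, hz, rfl⟩ := Finset.mem_image.mp hy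
    rw [Multiset.mem_toFinset, Polynomial.mem_roots hP0] at hz
    have hz' : z ^ p ^ f = z := by
      simpa [P, Polynomial.IsRoot, sub_eq_zero] using hz
    rw [Multiset.mem_toFinset, Polynomial.mem_roots hQ0]
    simp only [Q, t, Polynomial.IsRoot, Polynomial.eval_sub, Polynomial.eval_pow,
      Polynomial.eval_X]
    rw [← map_pow, ← map_pow, hz', sub_self]
  -- The Teichmüller lifts already give `p ^ f` distinct roots of a polynomial of that degree, so
  -- there are no others.
  have heq := Finset.eq_of_subset_of_card_le hsub (by
    rw [Finset.card_image_of_injective _ ht, hPcard, ← hQd]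
    exact (Multiset.toFinset_card_le _).trans (Polynomial.card_roots' Q))
  have hxQ : x ∈ Q.roots.toFinset := by
    rw [Multiset.mem_toFinset, Polynomial.mem_roots hQ0]
    simp [Q, Polynomial.IsRoot, hx]
  rw [← heq, Finset.mem_image] at hxQ
  obtain ⟨z, -, rfl⟩ := hxQ
  exact ⟨_, rfl⟩

end Unramified

/-! ### Arithmetic of the ring `R[π]`. -/

section Ramified

variable {p : ℕ} [Fact p.Prime] {π : UnramClosure p}

theorem algebraMap_padicInt_eq (E : IntermediateField ℚ_[p] (UnramClosure p))
    (c : ℤ_[p]) : (((algebraMap ℤ_[p] (integralClosure ℤ_[p] E) c : integralClosure ℤ_[p] E) : E) :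
      UnramClosure p) = algebraMap (UnramRing p) (UnramClosure p) (algebraMap ℤ_[p] _ c) := by
  have : IsScalarTower ℤ_[p] ℚ_[p] E := inferInstance
  have : IsScalarTower ℚ_[p] E (UnramClosure p) := inferInstance
  have h1 : ((algebraMap ℤ_[p] (integralClosure ℤ_[p] E) c : integralClosure ℤ_[p] E) : E) =
    algebraMap ℤ_[p] E c := rfl
  have h2 := IsScalarTower.algebraMap_apply ℤ_[p] ℚ_[p] E c
  rw [h1, h2, ← IntermediateField.algebraMap_apply, ← IsScalarTower.algebraMap_apply ℚ_[p] E (UnramClosure p),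
    IsScalarTower.algebraMap_apply ℚ_[p] (UnramField p) (UnramClosure p),
    ← IsScalarTower.algebraMap_apply ℤ_[p] ℚ_[p] (UnramField p),
    IsScalarTower.algebraMap_apply (UnramRing p) (UnramField p) (UnramClosure p),
    IsScalarTower.algebraMap_apply ℤ_[p] (UnramRing p) (UnramField p)]

end Ramified

section Ramified

variable {p : ℕ} [Fact p.Prime] {π : UnramClosure p}

theorem isIntegral_coe_integralClosure (E : IntermediateField ℚ_[p] (UnramClosure p))
    (a : integralClosure ℤ_[p] E) : IsIntegral (UnramRing p) ((a : E) : UnramClosure p) := by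
  obtain ⟨f, hf, hfa⟩ := Algebra.IsIntegral.isIntegral (R := ℤ_[p]) a
  refine ⟨f.map (algebraMap ℤ_[p] (UnramRing p)), hf.map _, ?_⟩
  let ι : integralClosure ℤ_[p] E →+* UnramClosure p :=
    (algebraMap E (UnramClosure p)).comp (algebraMap (integralClosure ℤ_[p] E) E)
  have h := congrArg ι hfa
  rw [map_zero, Polynomial.hom_eval₂] at h
  rw [Polynomial.eval₂_map, ← h]
  congr 1

/-- The ring of integers of `E` is contained in `R[π]` if `π` is a prime element of `E`. -/
theorem coe_integralClosure_mem_ramRing (E : IntermediateField ℚ_[p] (UnramClosure p))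
    [FiniteDimensional ℚ_[p] E] {ϖ : integralClosure ℤ_[p] E} (hϖ : Prime ϖ)
    (a : integralClosure ℤ_[p] E) :
    ((a : E) : UnramClosure p) ∈ RamRing (p := p) ((ϖ : E) : UnramClosure p) := by
  have hfin : Module.Finite ℤ_[p] (integralClosure ℤ_[p] E) :=
    IsIntegralClosure.finite ℤ_[p] ℚ_[p] E _
  let ι : integralClosure ℤ_[p] E →+* UnramClosure p :=
    (algebraMap E (UnramClosure p)).comp (algebraMap (integralClosure ℤ_[p] E) E)
  set S := RamRing (p := p) (ι ϖ) with hS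
  change ι a ∈ S
  have hπ : ι ϖ ∈ S := Algebra.subset_adjoin rfl
  have hstep : ∀ a, ∃ n ∈ S, ∃ z, ι a = n + ι ϖ * ι z := by
    intro a
    obtain ⟨f, ω, hf, hω, z, hz⟩ := exists_teichmuller (p := p) hϖ a
    obtain ⟨r, hr⟩ := exists_algebraMap_eq_of_pow_eq hf (x := ι ω) (by rw [← map_pow, hω])
    refine ⟨ι ω, hr ▸ S.algebraMap_mem r, z, ?_⟩
    rw [← map_mul, ← hz, ← map_add, add_sub_cancel]
  have hiter : ∀ k a, ∃ n ∈ S, ∃ z, ι a = n + ι ϖ ^ k * ι z := by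
    intro k
    induction k with
    | zero => exact fun a => ⟨0, S.zero_mem, a, by simp⟩
    | succ k ih =>
      intro a
      obtain ⟨n, hn, z, hz⟩ := ih a
      obtain ⟨n', hn', z', hz'⟩ := hstep z
      exact ⟨n + ι ϖ ^ k * n', S.add_mem hn (S.mul_mem (S.pow_mem hπ k) hn'), z', by
        rw [hz, hz']; ring⟩
  obtain ⟨k, w, hw⟩ := natCast_dvd_pow_of_prime (p := p) hϖ
  let M : Submodule (UnramRing p) (UnramClosure p) := Submodule.span _ (Set.range ι)
  have hM : M.FG := by
    obtain ⟨r, b, hb⟩ := Module.Finite.exists_fin (R := ℤ_[p]) (M := integralClosure ℤ_[p] E)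
    have : M = Submodule.span _ (Set.range fun j => ι (b j)) := by
      refine le_antisymm (Submodule.span_le.mpr ?_)
        (Submodule.span_mono (Set.range_subset_iff.mpr fun j => ⟨b j, rfl⟩))
      rintro _ ⟨x, rfl⟩
      obtain ⟨c, rfl⟩ := (Submodule.mem_span_range_iff_exists_fun ℤ_[p]).mp
        (hb ▸ Submodule.mem_top (x := x))
      rw [map_sum]
      refine Submodule.sum_mem _ fun j _ => ?_
      rw [Algebra.smul_def, map_mul, show ι (algebraMap ℤ_[p] _ (c j)) =
        algebraMap (UnramRing p) (UnramClosure p) (algebraMap ℤ_[p] _ (c j)) from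
          algebraMap_padicInt_eq E (c j), ← Algebra.smul_def]
      exact Submodule.smul_mem _ _ (Submodule.subset_span ⟨j, rfl⟩)
    rw [this]
    exact Submodule.fg_span (Set.finite_range _)
  -- Since `p ∣ ϖ ^ k`, the expansion `hiter` shows that `M` is contained in `S + p M`. As `M` is
  -- finitely generated over the local ring `R`, Nakayama's lemma applies.
  have hle : M ≤ Subalgebra.toSubmodule S := by
    refine Submodule.le_of_le_smul_of_le_jacobson_bot (I := IsLocalRing.maximalIdeal (UnramRing p))
      hM (IsLocalRing.maximalIdeal_le_jacobson _) (Submodule.span_le.mpr ?_)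
    rintro _ ⟨x, rfl⟩
    obtain ⟨n, hn, z, hz⟩ := hiter k x
    refine Submodule.mem_sup.mpr ⟨n, hn, (p : UnramRing p) • ι (w * z),
      Submodule.smul_mem_smul ?_ (Submodule.subset_span ⟨_, rfl⟩), ?_⟩
    · rw [(WittVector.irreducible p).maximalIdeal_eq]
      exact Ideal.mem_span_singleton_self _
    · rw [hz, ← map_pow, hw, Algebra.smul_def, map_natCast, map_mul, map_mul, map_natCast]
      ring
  exact hle (Submodule.subset_span ⟨a, rfl⟩)

theorem RamRing.natCast_ne_zero : (p : RamRing π) ≠ 0 := by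
  intro h
  have h1 := congrArg (algebraMap (RamRing π) (UnramClosure p)) h
  rw [map_natCast, map_zero] at h1
  have h2 : algebraMap (UnramRing p) (UnramClosure p) (p : UnramRing p) = 0 := by
    rw [map_natCast, h1]
  rw [← map_zero (algebraMap (UnramRing p) (UnramClosure p))] at h2
  exact UnramRing.natCast_ne_zero (algebraMap_unramClosure_injective h2)

theorem IsGaloisPrimeElement.isIntegral (hπ : IsGaloisPrimeElement π) :
    IsIntegral (UnramRing p) π := by
  obtain ⟨E, -, -, ϖ, -, rfl⟩ := hπ
  exact isIntegral_coe_integralClosure E ϖ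

theorem IsGaloisPrimeElement.unif_dvd_natCast (hπ : IsGaloisPrimeElement π) :
    RamRing.unif π ∣ (p : RamRing π) := by
  obtain ⟨E, hE, -, ϖ, hϖ, rfl⟩ := hπ
  have hfin : Module.Finite ℤ_[p] (integralClosure ℤ_[p] E) :=
    IsIntegralClosure.finite ℤ_[p] ℚ_[p] E _
  obtain ⟨c, hc⟩ := dvd_natCast_of_prime (p := p) hϖ
  refine ⟨⟨_, coe_integralClosure_mem_ramRing E hϖ c⟩, Subtype.ext ?_⟩
  have := congrArg (fun x : integralClosure ℤ_[p] E => ((x : E) : UnramClosure p)) hc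
  simpa [RamRing.unif] using this

theorem IsGaloisPrimeElement.natCast_dvd_pow (hπ : IsGaloisPrimeElement π) :
    ∃ e, (p : RamRing π) ∣ RamRing.unif π ^ e := by
  obtain ⟨E, hE, -, ϖ, hϖ, rfl⟩ := hπ
  have hfin : Module.Finite ℤ_[p] (integralClosure ℤ_[p] E) :=
    IsIntegralClosure.finite ℤ_[p] ℚ_[p] E _
  obtain ⟨k, c, hc⟩ := natCast_dvd_pow_of_prime (p := p) hϖ
  refine ⟨k, ⟨_, coe_integralClosure_mem_ramRing E hϖ c⟩, Subtype.ext ?_⟩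
  have := congrArg (fun x : integralClosure ℤ_[p] E => ((x : E) : UnramClosure p)) hc
  simpa [RamRing.unif] using this

/-- An inverse of `p` would be integral over the integrally closed ring `R` and lie in its fraction
field, so `p` would be invertible in `R`. -/
theorem IsGaloisPrimeElement.not_isUnit_natCast (hπ : IsGaloisPrimeElement π) :
    ¬ IsUnit (p : RamRing π) := by
  intro h
  obtain ⟨y, hy⟩ := h.exists_right_inv
  have hint : IsIntegral (UnramRing p) (y : UnramClosure p) :=
    (Algebra.adjoin_le (S := integralClosure (UnramRing p) (UnramClosure p))
      (Set.singleton_subset_iff.mpr hπ.isIntegral)) y.2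
  have hy' : (p : UnramClosure p) * y = 1 := by
    have := congrArg Subtype.val hy
    exact_mod_cast this
  have hp0 : (p : UnramClosure p) ≠ 0 := left_ne_zero_of_mul_eq_one hy'
  have hyK : (y : UnramClosure p) = algebraMap (UnramField p) (UnramClosure p) (p : UnramField p)⁻¹ := by
    rw [map_inv₀, map_natCast]
    exact eq_inv_of_mul_eq_one_right hy'
  rw [hyK, isIntegral_algebraMap_iff (algebraMap (UnramField p) (UnramClosure p)).injective] at hint
  obtain ⟨r, hr⟩ := IsIntegrallyClosed.isIntegral_iff.mp hint
  refine UnramRing.not_isUnit_natCast (p := p) (IsUnit.of_mul_eq_one r ?_)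
  apply algebraMap_unramClosure_injective
  rw [map_mul, map_natCast, map_one,
    IsScalarTower.algebraMap_apply (UnramRing p) (UnramField p) (UnramClosure p), hr, ← hyK, hy']

theorem IsGaloisPrimeElement.not_isUnit_unif (hπ : IsGaloisPrimeElement π) :
    ¬ IsUnit (RamRing.unif π) := by
  intro h
  obtain ⟨e, he⟩ := hπ.natCast_dvd_pow
  exact hπ.not_isUnit_natCast (isUnit_of_dvd_unit he (h.pow e))

theorem RamRing.exists_unif_dvd_sub (a : RamRing π) :
    ∃ r : UnramRing p, RamRing.unif π ∣ a - algebraMap _ _ r := by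
  obtain ⟨a, ha⟩ := a
  induction ha using Algebra.adjoin_induction with
  | mem x hx =>
    obtain rfl := Set.mem_singleton_iff.mp hx
    exact ⟨0, by rw [map_zero, sub_zero]; exact dvd_rfl⟩
  | algebraMap r => exact ⟨r, (dvd_zero _).trans (sub_self (algebraMap _ (RamRing π) r)).symm.dvd⟩
  | add x y hx hy ihx ihy =>
    obtain ⟨r, hr⟩ := ihx
    obtain ⟨t, ht⟩ := ihy
    refine ⟨r + t, ?_⟩
    have := dvd_add hr ht
    rw [sub_add_sub_comm, ← map_add] at this
    exact this
  | mul x y hx hy ihx ihy =>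
    obtain ⟨r, hr⟩ := ihx
    obtain ⟨t, ht⟩ := ihy
    refine ⟨r * t, ?_⟩
    have := dvd_add (hr.mul_right ⟨y, hy⟩) (ht.mul_left (algebraMap _ _ r))
    rw [map_mul]
    convert this using 1
    rw [sub_mul, mul_sub, sub_add_sub_cancel]
    rfl

/-- Modulo `π` the element `τ(π)` is congruent to some `r` in `R`. As `π` divides `p`, which divides
`τ(π) ^ e`, it divides `r ^ e`. So `r` is not a unit, hence is divisible by `p` and therefore by
`π`. -/
theorem IsGaloisPrimeElement.unif_dvd_map (hπ : IsGaloisPrimeElement π)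
    (τ : RamRing π ≃ₐ[UnramRing p] RamRing π) : RamRing.unif π ∣ τ (RamRing.unif π) := by
  obtain ⟨e, he⟩ := hπ.natCast_dvd_pow
  obtain ⟨r, hr⟩ := RamRing.exists_unif_dvd_sub (τ (RamRing.unif π))
  have h1 : RamRing.unif π ∣ τ (RamRing.unif π) ^ e := by
    have := map_dvd τ he
    rw [map_natCast, map_pow] at this
    exact hπ.unif_dvd_natCast.trans this
  have h2 : RamRing.unif π ∣ algebraMap _ (RamRing π) r ^ e := by
    have := dvd_sub h1 (hr.trans (sub_dvd_pow_sub_pow _ _ e))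
    rwa [sub_sub_cancel] at this
  have h3 : ¬ IsUnit r := fun h =>
    hπ.not_isUnit_unif (isUnit_of_dvd_unit h2 ((h.map (algebraMap _ (RamRing π))).pow e))
  have h4 := map_dvd (algebraMap (UnramRing p) (RamRing π)) (UnramRing.natCast_dvd_of_not_isUnit h3)
  rw [map_natCast] at h4
  have := dvd_add hr (hπ.unif_dvd_natCast.trans h4)
  rwa [sub_add_cancel] at this

/-- Roots of unity of order prime to `p` that agree modulo `ϖ` are equal. -/
theorem eq_of_pow_eq_one_of_dvd_sub {S : Type*} [CommRing S] [IsDomain S] {ϖ : S} {m : ℕ}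
    (hϖ : ϖ ∣ (p : S)) (hu : ¬ IsUnit ϖ) (hm : Nat.Coprime p m) {y z : S} (hy : y ^ m = 1)
    (hz : z ^ m = 1) (h : ϖ ∣ y - z) : y = z := by
  have hm0 : m ≠ 0 := by
    rintro rfl
    exact (Fact.out : p.Prime).ne_one (by simpa using hm)
  -- The quotient `y / z`. If it were not 1, the sum of its first `m` powers would vanish while
  -- being congruent to `m` mod `ϖ`, so `ϖ` would divide both `m` and `p`.
  set t := y * z ^ (m - 1) with ht
  have hz' : z * z ^ (m - 1) = 1 := by
    rw [← pow_succ', Nat.sub_add_cancel (Nat.pos_of_ne_zero hm0), hz]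
  have htm : t ^ m = 1 := by
    rw [ht, mul_pow, hy, one_mul, ← pow_mul, mul_comm, pow_mul, hz, one_pow]
  have ht1 : ϖ ∣ t - 1 := by
    rw [ht, ← hz', ← sub_mul]
    exact h.mul_right _
  have : t = 1 := by
    by_contra hne
    have h3 := mul_geom_sum t m
    rw [htm, sub_self] at h3
    have h4 := (mul_eq_zero.mp h3).resolve_left (sub_ne_zero.mpr hne)
    have h5 : ϖ ∣ ∑ i ∈ Finset.range m, (t ^ i - 1) := Finset.dvd_sum fun i _ =>
      ht1.trans (by simpa using sub_dvd_pow_sub_pow t 1 i)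
    rw [Finset.sum_sub_distrib, h4, zero_sub, dvd_neg] at h5
    have h6 : ϖ ∣ (m : S) := by simpa using h5
    obtain ⟨a, b, hab⟩ := (Nat.isCoprime_iff_coprime.mpr hm)
    have h7 : (a : S) * p + b * m = 1 := by exact_mod_cast congrArg (Int.cast (R := S)) hab
    exact hu (isUnit_of_dvd_one (h7 ▸ dvd_add (hϖ.mul_left _) (h6.mul_left _)))
  calc y = y * (z * z ^ (m - 1)) := by rw [hz', mul_one]
    _ = z * t := by rw [ht]; ring
    _ = z := by rw [this, mul_one]

/-- Both sides are roots of unity of exponent `orderOf d`, which is prime to `p`, and they agree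
modulo `π`. -/
theorem IsGaloisPrimeElement.map_root_of_unity (hp : p ≠ 2) (hπ : IsGaloisPrimeElement π) {s : ℕ}
    {φ : RamRing π →+* RamRing π} (hφ : IsFrobLift p s (RamRing.unif π) φ) {d : UnramRing p}
    (hd : IsOfFinOrder d) :
    φ (algebraMap (UnramRing p) (RamRing π) d) =
      algebraMap (UnramRing p) (RamRing π) d ^ p ^ s := by
  have h1 : algebraMap (UnramRing p) (RamRing π) d ^ orderOf d = 1 := by
    rw [← map_pow, pow_orderOf_eq_one, map_one]
  refine eq_of_pow_eq_one_of_dvd_sub hπ.unif_dvd_natCast hπ.not_isUnit_unif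
    (UnramRing.orderOf_coprime hp hd) ?_ ?_ (hφ _)
  · rw [← map_pow, h1, map_one]
  · rw [← pow_mul, mul_comm, pow_mul, h1, one_pow]

end Ramified

end ArithGeom

theorem mainTheorem10 (p : ℕ) [Fact p.Prime] (hp : p ≠ 2)
    (π : UnramClosure p) (hπ : IsGaloisPrimeElement π)
    (s : ℕ) (hs : 0 < s) (n : ℕ) (φ : Fin n → RamRing π →+* RamRing π)
    (hφ : ∀ i, IsFrobLift p s (RamRing.unif π) (φ i))
    (T : Subgroup (RamRing π ≃ₐ[UnramRing p] RamRing π)) (hT : ∀ i, Normalizes (φ i) T) :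
    (∀ (N : ℕ) (u : T →* gaugeGroup (UnramRing p) (S := RamRing π) N)
        (q : GL (Fin N) (RamRing π)), q.val.IsSymm →
      IsInvariantCocycle φ u → IsCompatibleMetric u q →
      (∃! D : PiConnection p s (RamRing.unif π) φ N, D.IsChern q) ∧
        ∀ D : PiConnection p s (RamRing.unif π) φ N, D.IsChern q →
          IsCompatibleConnection u D ∧ DescendsToTorsor D u) ∧
    ∃ c : RamRing π, c * RamRing.unif π = (p : RamRing π) ∧
      ∀ (u : T →* gaugeGroup (UnramRing p) (S := RamRing π) n) (q : GL (Fin n) (RamRing π)),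
        q.val.IsSymm → IsInvariantCocycle φ u → IsCompatibleMetric u q →
        ∀ L : TorsionSymbol p (UnramRing p) n,
          (∃! D : PiConnection p s (RamRing.unif π) φ n,
            D.IsLeviCivita q ((L.baseChange (RamRing π)).scale c)) ∧
          ∀ D : PiConnection p s (RamRing.unif π) φ n,
            D.IsLeviCivita q ((L.baseChange (RamRing π)).scale c) →
              IsCompatibleConnection u D ∧ DescendsToTorsor D u := by
  have hodd : Odd p := (Fact.out : p.Prime).odd_of_ne_two hp
  have hp0 : (p : RamRing π) ≠ 0 := RamRing.natCast_ne_zero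
  have hϖ := hπ.unif_dvd_natCast
  obtain ⟨e, he⟩ := hπ.natCast_dvd_pow
  have hζ : ∀ i, ∀ d : UnramRing p, IsOfFinOrder d →
      φ i (algebraMap (UnramRing p) (RamRing π) d) =
        algebraMap (UnramRing p) (RamRing π) d ^ p ^ s :=
    fun i d hd => hπ.map_root_of_unity hp (hφ i) hd
  have hϖT : ∀ τ : T, RamRing.unif π ∣ τ.1 (RamRing.unif π) := fun τ => hπ.unif_dvd_map τ.1
  refine ⟨fun N u q hq hinv hu => ⟨?_, fun D hD => ?_⟩, ?_⟩
  · have h := PiConnection.existsUnique_of_Lam hϖ he hφ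
      (existsUnique_chern_Lam hodd hp0 hϖ he hφ hq)
    simpa only [← PiConnection.isChern_iff] using h
  · have h := hD.isCompatibleConnection hodd hp0 hϖ he hφ hζ hϖT hT hinv hq hu
    exact ⟨h, descendsToTorsor_of_isCompatibleConnection hT h⟩
  -- The element `c` is `p / π`.
  · obtain ⟨c, hc⟩ := hϖ
    have hc' : c * RamRing.unif π = (p : RamRing π) := by rw [hc, mul_comm]
    refine ⟨c, hc', fun u q hq hinv hu L => ⟨?_, fun D hD => ?_⟩⟩
    · have h := PiConnection.existsUnique_of_Lam hπ.unif_dvd_natCast he hφ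
        (existsUnique_leviCivita_Lam hodd hp0 hc' he hφ hq (L.baseChange (RamRing π)))
      simpa only [← PiConnection.isLeviCivita_iff hp0 hc'] using h
    · have h := hD.isCompatibleConnection hodd hp0 hc' he hφ hζ hϖT hT hinv hq hu L
      exact ⟨h, descendsToTorsor_of_isCompatibleConnection hT h⟩
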